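/- A temporal graph $\mathcal{G}=(V,E,\lambda)$ consists of a finite simple graph $(V,E)$ and a map $\lambda$ assigning to every edge a finite set of positive real time labels. A time-respecting path arriving by time $t$ is a (possibly trivial) path of $(V,E)$ together with a choice of one label for each of its edges such that the chosen labels are strictly increasing along the path and are all at most $t$. For $S\subseteq V$ and $t\in\mathbb{N}_0$, let $B_{\mathcal{G}}(S,t)$ be the set of vertices reachable from some vertex of $S$ by a time-respecting path arriving by time $t$. Let $\mathrm{Double}_{\mathcal{G}}(S)=\min\{t\in\mathbb{N}_0 : |B_{\mathcal{G}}(S,t)|\ge 2|S|\}$, with value $\infty$ if no such $t$ exists. The doubling time of $\mathcal{G}$ is $$\mathbf{Double}(\mathcal{G})=\max_{S\subseteq V,\ |S|\le |V|/2}\mathrm{Double}_{\mathcal{G}}(S)\in\mathbb{N}_0\cup\{\infty\}.$$ The Random Simple Temporal Graph (RSTG) on $[n]$ with parameter $p\in[0,1]$ is obtained by drawing an Erdős–Rényi graph $G(n,p)$ and then ordering its edges uniformly at random, the single label of each edge being its position $1,2,\dots,|E|$ in this order. **Corollary (RSTG doubling time).** Let $\beta:\mathbb{N}\to[0,1]$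 and, for each $n$, let $\mathcal{H}_n$ be a sample from the RSTG distribution on $[n]$ with parameter $\beta(n)$. 1. If there is a constant $c>0$ such that $\beta(n)>(2+c)\frac{\log n}{n}$ for all sufficiently large $n$, then $\mathbb{P}[\mathbf{Double}(\mathcal{H}_n)<\infty]\to 1$ as $n\to\infty$. 2. If there is a constant $c>0$ such that $\beta(n)<(2-c)\frac{\log n}{n}$ for all sufficiently large $n$, then $\mathbb{P}[\mathbf{Double}(\mathcal{H}_n)=\infty]\to 1$ as $n\to\infty$. -/

import Mathlib

open Filter Topology MeasureTheory

/-- A temporal graph on the vertex set `V`: a static graph together with a labelling that assigns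
to every edge a finite set of positive real time labels. -/
structure TemporalGraph (V : Type*) where
  /-- The underlying static graph. -/
  graph : SimpleGraph V
  /-- The finite set of time labels of an edge. -/
  label : graph.edgeSet → Finset ℝ
  label_pos : ∀ e, ∀ s ∈ label e, 0 < s

namespace TemporalGraph

variable {V : Type*}

/-- `H.Reaches u v t`: there is a time-respecting path from `u` to `v` arriving by time `t`, i.e.
a path of the underlying graph, and a choice of one label `ℓ i` for each of its edges, such that
the chosen labels strictly increase along the path and none of them exceeds `t`. The trivial path
from `u` to `u` arrives by every time. -/
def Reaches (H : TemporalGraph V) (u v : V) (t : ℝ) : Prop :=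
  ∃ (p : H.graph.Walk u v) (ℓ : List ℝ), p.IsPath ∧
    List.Forall₂ (fun e s => ∃ he : e ∈ H.graph.edgeSet, s ∈ H.label ⟨e, he⟩) p.edges ℓ ∧
    ℓ.Pairwise (· < ·) ∧ ∀ s ∈ ℓ, s ≤ t

/-- The `t`-step reachability ball of a set `S` of vertices. -/
def ball (H : TemporalGraph V) (S : Finset V) (t : ℕ) : Set V :=
  {v | ∃ u ∈ S, H.Reaches u v t}

/-- The doubling time of a set `S` of vertices: the least `t : ℕ` at which the reachability ball
has at least `2 |S|` elements, and `⊤` if there is no such `t`. -/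
noncomputable def doubleOf (H : TemporalGraph V) (S : Finset V) : ℕ∞ :=
  ⨅ (t : ℕ) (_ : 2 * S.card ≤ (H.ball S t).ncard), (t : ℕ∞)

/-- The doubling time of a temporal graph: the maximum of the doubling times of the sets of at most
half of the vertices. -/
noncomputable def double (H : TemporalGraph V) : ℕ∞ :=
  ⨆ (S : Finset V) (_ : 2 * S.card ≤ Nat.card V), H.doubleOf S

/-- A linear order on the edges of `G`, given as a bijection of the edges onto their ranks. -/
abbrev EdgeOrder (G : SimpleGraph V) : Type _ :=
  G.edgeSet ≃ Fin (Nat.card G.edgeSet)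

/-- The simple temporal graph in which each edge of `G` has exactly one label, its position
`1, 2, …, |E(G)|` in the order `σ`. -/
noncomputable def ofEdgeOrder (G : SimpleGraph V) (σ : EdgeOrder G) : TemporalGraph V where
  graph := G
  label e := {((σ e : ℕ) : ℝ) + 1}
  label_pos e s hs := by
    rw [Finset.mem_singleton] at hs
    subst hs
    positivity

instance [Finite V] (G : SimpleGraph V) : Nonempty (EdgeOrder G) :=
  ⟨Finite.equivFin _⟩

/-- The uniform distribution on the linear orders of the edges of `G`. -/
noncomputable def uniformEdgeOrder [Finite V] (G : SimpleGraph V) : PMF (EdgeOrder G) :=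
  letI : Fintype (EdgeOrder G) := Fintype.ofFinite _
  PMF.uniformOfFintype (EdgeOrder G)

/-- Every set of temporal graphs is an event. -/
instance : MeasurableSpace (TemporalGraph V) := ⊤

instance [Finite V] : MeasurableSingletonClass (SimpleGraph V) where
  measurableSet_singleton G := by
    rw [← SimpleGraph.measurableEmbedding_edgeSet.measurableSet_image, Set.image_singleton]
    exact MeasurableSet.singleton _

/-- The Random Simple Temporal Graph distribution on the vertex set `V` with parameter `p`: draw an
Erdős–Rényi graph, in which each pair of vertices is an edge independently with probability `p`,
and then order its edges uniformly at random. -/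
noncomputable def rstg (V : Type*) [Finite V] (p : unitInterval) : PMF (TemporalGraph V) :=
  (SimpleGraph.binomialRandom V p).toPMF.bind fun G =>
    (uniformEdgeOrder G).map (ofEdgeOrder G)

end TemporalGraph

namespace TemporalGraph

/-! ### Sampling the edge order through independent time slots -/

section Order

variable {E κ : Type*} [LinearOrder κ] {M : ℕ}

/-- An order of `E` refines the slot assignment `X` if elements in earlier slots come first. -/
def Refines (X : E → κ) (σ : E ≃ Fin M) : Prop :=
  ∀ e e', X e < X e' → σ e < σ e'

theorem exists_refines (X : E → κ) (σ₀ : E ≃ Fin M) : ∃ σ : E ≃ Fin M, Refines X σ := by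
  refine ⟨σ₀.trans (Tuple.sort (X ∘ σ₀.symm)).symm, fun e e' h => ?_⟩
  by_contra hle
  have := Tuple.monotone_sort (X ∘ σ₀.symm) (not_lt.1 hle)
  simp at this
  exact absurd h (not_lt.2 this)

theorem refines_comp_iff (X : E → κ) (σ : E ≃ Fin M) (π : Equiv.Perm E) :
    Refines (X ∘ π) (π.trans σ) ↔ Refines X σ := by
  constructor
  · intro h e e' hlt
    simpa using h (π.symm e) (π.symm e') (by simpa using hlt)
  · intro h e e' hlt
    exact h _ _ hlt

open scoped Classical in
/-- If every order refining a slot assignment of `B` lies in `A`, then the proportion of `B` among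
the slot assignments is at most that of `A` among the orders. -/
theorem card_mul_card_le_of_refines [Fintype E] [Fintype κ] [Fintype (E ≃ Fin M)]
    [Nonempty (E ≃ Fin M)]
    (A : Finset (E ≃ Fin M)) (B : Finset (E → κ))
    (h : ∀ X ∈ B, ∀ σ, Refines X σ → σ ∈ A) :
    (B.card : ℝ) * Fintype.card (E ≃ Fin M) ≤ A.card * (Fintype.card κ : ℝ) ^ Fintype.card E := by
  let c : (E → κ) → ℝ := fun X => ((Finset.univ.filter fun σ : E ≃ Fin M => Refines X σ).card : ℝ)
  have hc : ∀ X, 0 < c X := by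
    intro X
    obtain ⟨σ, hσ⟩ := exists_refines X (Classical.arbitrary (E ≃ Fin M))
    exact Nat.cast_pos.2 (Finset.card_pos.2 ⟨σ, by simpa using hσ⟩)
  have hcπ : ∀ X (π : Equiv.Perm E), c (X ∘ π) = c X := by
    intro X π
    simp only [c, Nat.cast_inj]
    refine Finset.card_bij' (fun σ _ => π.symm.trans σ) (fun σ _ => π.trans σ) ?_ ?_ ?_ ?_
    · intro σ hσ
      simp only [Finset.mem_filter, Finset.mem_univ, true_and] at hσ ⊢
      rw [← refines_comp_iff X _ π]
      convert hσ using 1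
      ext; simp
    · intro σ hσ
      simp only [Finset.mem_filter, Finset.mem_univ, true_and] at hσ ⊢
      exact (refines_comp_iff X _ π).2 hσ
    · intro σ _; ext; simp
    · intro σ _; ext; simp
  let g : (E ≃ Fin M) → ℝ := fun τ => ∑ X : E → κ, if Refines X τ then (c X)⁻¹ else 0
  have hg : ∀ τ τ', g τ = g τ' := by
    intro τ τ'
    let π : Equiv.Perm E := τ.trans τ'.symm
    have hτ : τ = π.trans τ' := by ext; simp [π]
    simp only [g]
    rw [← Equiv.sum_comp (Equiv.arrowCongr π.symm (Equiv.refl κ))]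
    refine Finset.sum_congr rfl fun X _ => ?_
    have hX : (Equiv.arrowCongr π.symm (Equiv.refl κ)) X = X ∘ π := by
      ext e; simp [Equiv.arrowCongr]
    rw [hX, hcπ]
    conv_lhs => rw [hτ]
    simp only [refines_comp_iff]
  let τ₀ : E ≃ Fin M := Classical.arbitrary _
  have hsum : ∑ τ, g τ = (Fintype.card κ : ℝ) ^ Fintype.card E := by
    simp only [g]
    rw [Finset.sum_comm]
    have : ∀ X : E → κ, (∑ τ : E ≃ Fin M, if Refines X τ then (c X)⁻¹ else 0) = 1 := by
      intro X
      rw [← Finset.sum_filter, Finset.sum_const, nsmul_eq_mul]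
      exact mul_inv_cancel₀ (hc X).ne'
    simp [this]
  have hconst : ∑ τ, g τ = Fintype.card (E ≃ Fin M) * g τ₀ := by
    rw [Finset.sum_congr rfl fun τ _ => hg τ τ₀]
    simp
  have hB : (B.card : ℝ) ≤ ∑ τ ∈ A, g τ := by
    simp only [g]
    rw [Finset.sum_comm]
    calc (B.card : ℝ) = ∑ X ∈ B, ∑ τ ∈ A, (if Refines X τ then (c X)⁻¹ else 0) := by
          rw [Finset.card_eq_sum_ones, Nat.cast_sum]
          refine Finset.sum_congr rfl fun X hX => ?_
          rw [← Finset.sum_filter, Finset.sum_const, nsmul_eq_mul]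
          have : A.filter (fun τ => Refines X τ) = Finset.univ.filter fun σ => Refines X σ := by
            ext σ
            simpa using fun hσ => h X hX σ hσ
          rw [this, Nat.cast_one]
          exact (mul_inv_cancel₀ (hc X).ne').symm
      _ ≤ _ := by
          refine Finset.sum_le_sum_of_subset_of_nonneg (Finset.subset_univ _) fun X _ _ => ?_
          refine Finset.sum_nonneg fun τ _ => ?_
          split_ifs
          · exact inv_nonneg.2 (hc X).le
          · exact le_rfl
  rw [Finset.sum_congr rfl fun τ _ => hg τ τ₀, Finset.sum_const, nsmul_eq_mul] at hB
  rw [← hsum, hconst]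
  calc (B.card : ℝ) * Fintype.card (E ≃ Fin M)
      ≤ (A.card * g τ₀) * Fintype.card (E ≃ Fin M) := by gcongr
    _ = _ := by ring

end Order

/-! ### Expectations under a product weight -/

section Expect

variable {E κ : Type*} [Fintype E] [DecidableEq E] [Fintype κ]

/-- The expectation of `f` when the coordinates are independent and coordinate `e` has the
(not necessarily normalised) law `w e`. -/
def expect (w : E → κ → ℝ) (f : (E → κ) → ℝ) : ℝ :=
  ∑ Y : E → κ, (∏ e, w e (Y e)) * f Y

theorem expect_mono {w : E → κ → ℝ} (hw : ∀ e s, 0 ≤ w e s) {f g : (E → κ) → ℝ}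
    (h : ∀ Y, f Y ≤ g Y) : expect w f ≤ expect w g :=
  Finset.sum_le_sum fun Y _ =>
    mul_le_mul_of_nonneg_left (h Y) (Finset.prod_nonneg fun e _ => hw e _)

theorem expect_add (w : E → κ → ℝ) (f g : (E → κ) → ℝ) :
    expect w (fun Y => f Y + g Y) = expect w f + expect w g := by
  simp [expect, mul_add, Finset.sum_add_distrib]

theorem expect_const_mul (w : E → κ → ℝ) (a : ℝ) (f : (E → κ) → ℝ) :
    expect w (fun Y => a * f Y) = a * expect w f := by
  simp only [expect, Finset.mul_sum]
  exact Finset.sum_congr rfl fun Y _ => by ring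

theorem expect_sum {ι : Type*} (w : E → κ → ℝ) (s : Finset ι) (f : ι → (E → κ) → ℝ) :
    expect w (fun Y => ∑ i ∈ s, f i Y) = ∑ i ∈ s, expect w (f i) := by
  simp only [expect, Finset.mul_sum]
  exact Finset.sum_comm

theorem expect_prod (w : E → κ → ℝ) (f : E → κ → ℝ) :
    expect w (fun Y => ∏ e, f e (Y e)) = ∏ e, ∑ s, w e s * f e s := by
  simp only [expect, ← Finset.prod_mul_distrib]
  rw [Finset.prod_univ_sum]
  simp

theorem expect_one (w : E → κ → ℝ) : expect w (fun _ => 1) = ∏ e, ∑ s, w e s := by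
  simpa using expect_prod w (fun _ _ => 1)

theorem expect_congr_of_ne_zero {w : E → κ → ℝ} {f g : (E → κ) → ℝ}
    (h : ∀ Y, (∀ e, w e (Y e) ≠ 0) → f Y = g Y) : expect w f = expect w g := by
  refine Finset.sum_congr rfl fun Y _ => ?_
  by_cases hY : ∀ e, w e (Y e) ≠ 0
  · rw [h Y hY]
  · push Not at hY
    obtain ⟨e, he⟩ := hY
    rw [Finset.prod_eq_zero (Finset.mem_univ e) he, zero_mul, zero_mul]

end Expect

section Slots

variable {V : Type*} {N : ℕ}

/-- The graph of the pairs that are assigned one of the first `N` slots; the last value of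
`Fin (N + 1)` stands for the absence of the edge. -/
def slotGraph (Y : Sym2 V → Fin (N + 1)) : SimpleGraph V :=
  SimpleGraph.fromEdgeSet {e | (Y e : ℕ) < N}

theorem mem_edgeSet_slotGraph {Y : Sym2 V → Fin (N + 1)} {e : Sym2 V} :
    e ∈ (slotGraph Y).edgeSet ↔ (Y e : ℕ) < N ∧ ¬ e.IsDiag := by
  simp [slotGraph]

open scoped Classical in
/-- The law of the slot of a pair: a proper pair is an edge with probability `p`, and then its
slot is uniform; a diagonal pair is never an edge. -/
noncomputable def slotWeight (N : ℕ) (p : ℝ) (e : Sym2 V) (s : Fin (N + 1)) : ℝ :=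
  if e.IsDiag then (if (s : ℕ) < N then 0 else 1) else if (s : ℕ) < N then p / N else 1 - p

theorem slotWeight_nonneg {p : ℝ} (h0 : 0 ≤ p) (h1 : p ≤ 1) (e : Sym2 V) (s : Fin (N + 1)) :
    0 ≤ slotWeight N p e s := by
  unfold slotWeight
  split_ifs <;> positivity

theorem sum_slotWeight (hN : 0 < N) (p : ℝ) (e : Sym2 V) : ∑ s, slotWeight N p e s = 1 := by
  have : (N : ℝ) ≠ 0 := by positivity
  rw [Fin.sum_univ_castSucc]
  by_cases h : e.IsDiag
  · simp [slotWeight, h]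
  · simp [slotWeight, h]
    field_simp
    ring

section
variable [Fintype V] [DecidableEq V]

theorem prod_edge_ite (G : SimpleGraph V) (a b : ℝ) [DecidablePred fun e : Sym2 V => e.IsDiag]
    [DecidablePred (· ∈ G.edgeSet)] :
    ∏ e : Sym2 V, (if e.IsDiag then 1 else if e ∈ G.edgeSet then a else b) =
      a ^ G.edgeSet.ncard * b ^ ((Nat.card V).choose 2 - G.edgeSet.ncard) := by
  have hd : (Finset.univ.filter fun e : Sym2 V => ¬ e.IsDiag).card = (Nat.card V).choose 2 := by
    rw [Nat.card_eq_fintype_card, ← Sym2.card_diagSet_compl, ← Fintype.card_subtype]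
    exact Fintype.card_congr (Equiv.subtypeEquivRight fun e => by simp)
  have hE : ((Finset.univ.filter fun e : Sym2 V => ¬ e.IsDiag).filter (· ∈ G.edgeSet)).card =
      G.edgeSet.ncard := by
    rw [← Set.ncard_coe_finset]
    congr 1
    ext e
    simpa using fun h => G.not_isDiag_of_mem_edgeSet h
  rw [Finset.prod_ite, Finset.prod_const_one, one_mul, Finset.prod_ite, Finset.prod_const,
    Finset.prod_const, hE]
  congr 2
  have := Finset.card_filter_add_card_filter_not
    (s := Finset.univ.filter fun e : Sym2 V => ¬ e.IsDiag) (p := (· ∈ G.edgeSet))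
  omega

open scoped Classical in
theorem prod_slotWeight_le (hN : 0 < N) {p : ℝ} (h0 : 0 ≤ p) (h1 : p ≤ 1) (G : SimpleGraph V)
    (S : Finset (Sym2 V → Fin (N + 1))) (B : Finset (G.edgeSet → Fin N))
    (hS : ∀ Y ∈ S, slotGraph Y = G ∧ ∀ X : G.edgeSet → Fin N,
      (∀ e, (X e : ℕ) = Y e) → X ∈ B) :
    ∑ Y ∈ S, ∏ e, slotWeight N p e (Y e) ≤
      (p / N) ^ G.edgeSet.ncard * (1 - p) ^ ((Nat.card V).choose 2 - G.edgeSet.ncard) *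
        B.card := by
  set W := (p / N) ^ G.edgeSet.ncard * (1 - p) ^ ((Nat.card V).choose 2 - G.edgeSet.ncard) with hW
  let S' := S.filter fun Y => ∀ e : Sym2 V, e.IsDiag → ¬ (Y e : ℕ) < N
  have hzero : ∀ Y ∈ S, Y ∉ S' → ∏ e, slotWeight N p e (Y e) = 0 := by
    intro Y hY hY'
    simp only [S', Finset.mem_filter, hY, true_and, not_forall, not_not] at hY'
    obtain ⟨e, he, hlt⟩ := hY'
    exact Finset.prod_eq_zero (Finset.mem_univ e) (by simp [slotWeight, he, hlt])
  have hmem : ∀ Y ∈ S, ∀ e, e ∈ G.edgeSet ↔ (Y e : ℕ) < N ∧ ¬ e.IsDiag := by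
    intro Y hY e
    rw [← (hS Y hY).1, mem_edgeSet_slotGraph]
  have hval : ∀ Y ∈ S', ∏ e, slotWeight N p e (Y e) = W := by
    intro Y hY
    obtain ⟨hY, hd⟩ := Finset.mem_filter.1 hY
    rw [hW, ← prod_edge_ite]
    refine Finset.prod_congr rfl fun e _ => ?_
    by_cases h : e.IsDiag
    · simp [slotWeight, h, hd e h]
    · simp [slotWeight, h, hmem Y hY e]
  have hsub : S' ⊆ S := Finset.filter_subset _ _
  rw [← Finset.sum_subset hsub hzero, Finset.sum_congr rfl hval, Finset.sum_const, nsmul_eq_mul,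
    mul_comm]
  have hWn : 0 ≤ W := by
    have : 0 ≤ 1 - p := by linarith
    positivity
  refine mul_le_mul_of_nonneg_left (Nat.cast_le.2 ?_) hWn
  have hmod : ∀ Y ∈ S, ∀ e : G.edgeSet, (Y e : ℕ) % N = Y e := fun Y hY e =>
    Nat.mod_eq_of_lt ((hmem Y hY e).1 e.2).1
  refine Finset.card_le_card_of_injOn (fun Y e => ⟨Y e % N, Nat.mod_lt _ hN⟩) ?_ ?_
  · intro Y hY
    exact (hS Y (hsub hY)).2 _ fun e => hmod Y (hsub hY) e
  · intro Y hY Y' hY' heq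
    ext e
    obtain ⟨hY, hd⟩ := Finset.mem_filter.1 hY
    obtain ⟨hY', hd'⟩ := Finset.mem_filter.1 hY'
    by_cases he : e ∈ G.edgeSet
    · have h2 := congrArg Fin.val (congrFun heq ⟨e, he⟩)
      simpa [hmod Y hY ⟨e, he⟩, hmod Y' hY' ⟨e, he⟩] using h2
    · have key : ∀ Z ∈ S, (∀ e : Sym2 V, e.IsDiag → ¬ (Z e : ℕ) < N) → (Z e : ℕ) = N := by
        intro Z hZ hZd
        have h1 := (Z e).is_lt
        by_cases hdiag : e.IsDiag
        · have := hZd e hdiag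
          omega
        · have : ¬ (Z e : ℕ) < N := fun h => he ((hmem Z hZ e).2 ⟨h, hdiag⟩)
          omega
      rw [key Y hY hd, key Y' hY' hd']

theorem rstg_toMeasure_eq_sum (p : unitInterval) (A : Set (TemporalGraph V)) :
    (rstg V p).toMeasure A = ∑ G : SimpleGraph V, SimpleGraph.binomialRandom V p {G} *
      (uniformEdgeOrder G).toOuterMeasure {σ | ofEdgeOrder G σ ∈ A} := by
  rw [PMF.toMeasure_apply_eq_toOuterMeasure_apply _ (MeasurableSpace.measurableSet_top), rstg,
    PMF.toOuterMeasure_bind_apply, tsum_fintype]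
  simp only [PMF.toOuterMeasure_map_apply, Measure.toPMF_apply]
  rfl

open scoped Classical in
/-- If every order refining a slot assignment in `S` produces a temporal graph in `A`, then the
probability of `A` is at least that of `S` under independent slots. -/
theorem expect_slotWeight_le_rstg (hN : 0 < N) (p : unitInterval)
    (S : Set (Sym2 V → Fin (N + 1))) [DecidablePred (· ∈ S)] (A : Set (TemporalGraph V))
    (h : ∀ Y ∈ S, ∀ σ : EdgeOrder (slotGraph Y),
      Refines (fun e : (slotGraph Y).edgeSet => Y e) σ → ofEdgeOrder (slotGraph Y) σ ∈ A) :
    ENNReal.ofReal (expect (slotWeight N p) (fun Y => if Y ∈ S then 1 else 0)) ≤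
      (rstg V p).toMeasure A := by
  let B : (G : SimpleGraph V) → Finset (G.edgeSet → Fin N) := fun G =>
    Finset.univ.filter fun X => ∀ σ : EdgeOrder G, Refines X σ → ofEdgeOrder G σ ∈ A
  have hE : expect (slotWeight N p) (fun Y => if Y ∈ S then 1 else 0) ≤
      ∑ G : SimpleGraph V, ((p : ℝ) / N) ^ G.edgeSet.ncard *
        (1 - p) ^ ((Nat.card V).choose 2 - G.edgeSet.ncard) * (B G).card := by
    simp only [expect, mul_ite, mul_one, mul_zero]
    rw [← Finset.sum_filter, ← Finset.sum_fiberwise _ slotGraph]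
    refine Finset.sum_le_sum fun G _ => ?_
    refine prod_slotWeight_le hN p.2.1 p.2.2 G _ _ fun Y hY => ?_
    simp only [Finset.mem_filter, Finset.mem_univ, true_and] at hY
    refine ⟨hY.2, fun X hX => ?_⟩
    obtain ⟨hYS, rfl⟩ := hY
    simp only [B, Finset.mem_filter, Finset.mem_univ, true_and]
    intro σ hσ
    refine h Y hYS σ fun e e' hlt => hσ e e' ?_
    rw [Fin.lt_def, hX, hX]
    exact hlt
  refine (ENNReal.ofReal_le_ofReal hE).trans ?_
  have hp : 0 ≤ 1 - (p : ℝ) := sub_nonneg.2 p.2.2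
  have hp0 : 0 ≤ (p : ℝ) := p.2.1
  rw [rstg_toMeasure_eq_sum, ENNReal.ofReal_sum_of_nonneg fun G _ => by positivity]
  refine Finset.sum_le_sum fun G _ => ?_
  let _ : Fintype (EdgeOrder G) := Fintype.ofFinite _
  have hcount := card_mul_card_le_of_refines
    (Finset.univ.filter fun σ : EdgeOrder G => ofEdgeOrder G σ ∈ A) (B G) (by
      intro X hX σ hσ
      simp only [B, Finset.mem_filter, Finset.mem_univ, true_and] at hX ⊢
      exact hX σ hσ)
  have hout : (uniformEdgeOrder G).toOuterMeasure {σ | ofEdgeOrder G σ ∈ A} =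
      ENNReal.ofReal (((Finset.univ.filter fun σ : EdgeOrder G => ofEdgeOrder G σ ∈ A).card : ℝ) /
        Fintype.card (EdgeOrder G)) := by
    rw [uniformEdgeOrder, PMF.toOuterMeasure_uniformOfFintype_apply,
      ENNReal.ofReal_div_of_pos (by exact_mod_cast Fintype.card_pos), ENNReal.ofReal_natCast,
      ENNReal.ofReal_natCast, ← Fintype.card_subtype]
    rfl
  have hG : SimpleGraph.binomialRandom V p {G} = ENNReal.ofReal ((p : ℝ) ^ G.edgeSet.ncard *
      (1 - p) ^ ((Nat.card V).choose 2 - G.edgeSet.ncard)) := by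
    rw [SimpleGraph.binomialRandom_singleton, ENNReal.ofReal_mul (by positivity),
      ENNReal.ofReal_pow hp0, ENNReal.ofReal_pow hp]
    congr 2
    · rw [← ENNReal.ofReal_coe_nnreal]
      rfl
    · rw [← ENNReal.ofReal_coe_nnreal]
      rfl
  rw [hout, hG, ← ENNReal.ofReal_mul (by positivity)]
  refine ENNReal.ofReal_le_ofReal ?_
  have hcard : Fintype.card G.edgeSet = G.edgeSet.ncard := by
    rw [Fintype.card_eq_nat_card, Nat.card_coe_set_eq]
  rw [hcard, Fintype.card_fin] at hcount
  have hN' : (0 : ℝ) < (N : ℝ) ^ G.edgeSet.ncard := by positivity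
  have hO : (0 : ℝ) < Fintype.card (EdgeOrder G) := by exact_mod_cast Fintype.card_pos
  have hratio : ((B G).card : ℝ) / (N : ℝ) ^ G.edgeSet.ncard ≤
      ((Finset.univ.filter fun σ : EdgeOrder G => ofEdgeOrder G σ ∈ A).card : ℝ) /
        Fintype.card (EdgeOrder G) := by
    rw [div_le_div_iff₀ hN' hO]
    exact hcount
  calc _ = (p : ℝ) ^ G.edgeSet.ncard * (1 - p) ^ ((Nat.card V).choose 2 - G.edgeSet.ncard) *
        (((B G).card : ℝ) / (N : ℝ) ^ G.edgeSet.ncard) := by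
          rw [div_pow]; ring
    _ ≤ _ := mul_le_mul_of_nonneg_left hratio (by positivity)

end
end Slots

/-! ### Exploring backwards in time -/

section Explore

variable {V : Type*} [Fintype V] [DecidableEq V] {N : ℕ}

/-- The set `U` together with its neighbours along pairs in slot `i`. -/
def slotStep (Y : Sym2 V → Fin (N + 1)) (i : ℕ) (U : Finset V) : Finset V :=
  Finset.univ.filter fun v => v ∈ U ∨ ∃ u ∈ U, (Y s(v, u) : ℕ) = i

/-- The vertices from which `U` can be reached by passing through slots below `i` in strictly
increasing order. -/
def revReach (Y : Sym2 V → Fin (N + 1)) : ℕ → Finset V → Finset V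
  | 0, U => U
  | i + 1, U => revReach Y i (slotStep Y i U)

theorem exists_path_of_mem_revReach (Y : Sym2 V → Fin (N + 1)) (i : ℕ) (hi : i ≤ N)
    (U : Finset V) (w : V) (hw : w ∈ revReach Y i U) :
    ∃ v ∈ U, ∃ p : (slotGraph Y).Walk w v, p.IsPath ∧ p.edges.Pairwise (fun e e' => Y e < Y e') ∧
      ∀ e ∈ p.edges, (Y e : ℕ) < i := by
  induction i generalizing U with
  | zero => exact ⟨w, hw, .nil, .nil, by simp, by simp⟩
  | succ i ih =>
    obtain ⟨u, hu, p, hp, hpw, hlt⟩ := ih (by omega) _ hw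
    simp only [slotStep, Finset.mem_filter, Finset.mem_univ, true_and] at hu
    by_cases huU : u ∈ U
    · exact ⟨u, huU, p, hp, hpw, fun e he => (hlt e he).trans (by omega)⟩
    obtain ⟨v, hv, hY⟩ := hu.resolve_left huU
    refine ⟨v, hv, ?_⟩
    by_cases hvp : v ∈ p.support
    · have hsub : (p.takeUntil v hvp).edges.Sublist p.edges := by
        conv_rhs => rw [← p.take_spec hvp, SimpleGraph.Walk.edges_append]
        exact List.sublist_append_left _ _
      exact ⟨p.takeUntil v hvp, hp.takeUntil hvp, hpw.sublist hsub,
        fun e he => (hlt e (hsub.subset he)).trans (by omega)⟩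
    · have hadj : (slotGraph Y).Adj u v := by
        rw [← SimpleGraph.mem_edgeSet, mem_edgeSet_slotGraph]
        refine ⟨by omega, ?_⟩
        rw [Sym2.mk_isDiag_iff]
        rintro rfl
        exact huU hv
      refine ⟨p.concat hadj, hp.concat hvp hadj, ?_, ?_⟩
      · rw [SimpleGraph.Walk.edges_concat, List.concat_eq_append, List.pairwise_append]
        refine ⟨hpw, List.pairwise_singleton _ _, fun e he e' he' => ?_⟩
        rw [List.mem_singleton] at he'
        subst he'
        rw [Fin.lt_def, hY]
        exact hlt e he
      · intro e he
        rw [SimpleGraph.Walk.edges_concat, List.concat_eq_append, List.mem_append,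
          List.mem_singleton] at he
        obtain he | rfl := he
        · exact (hlt e he).trans (by omega)
        · omega

open scoped Classical in
theorem exists_reaches_of_mem_revReach (Y : Sym2 V → Fin (N + 1))
    (σ : EdgeOrder (slotGraph Y)) (hσ : Refines (fun e : (slotGraph Y).edgeSet => Y e) σ)
    (U : Finset V) (w : V) (hw : w ∈ revReach Y N U) :
    ∃ v ∈ U, (ofEdgeOrder (slotGraph Y) σ).Reaches w v
      (Nat.card (slotGraph Y).edgeSet : ℕ) := by
  obtain ⟨v, hv, p, hp, hpw, -⟩ := exists_path_of_mem_revReach Y N le_rfl U w hw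
  let lab : Sym2 V → ℝ := fun e =>
    if h : e ∈ (slotGraph Y).edgeSet then ((σ ⟨e, h⟩ : ℕ) : ℝ) + 1 else 0
  have hlab : ∀ e (h : e ∈ (slotGraph Y).edgeSet), lab e = ((σ ⟨e, h⟩ : ℕ) : ℝ) + 1 :=
    fun e h => dif_pos h
  refine ⟨v, hv, p, p.edges.map lab, hp, ?_, ?_, ?_⟩
  · refine List.forall₂_map_right_iff.2 (List.forall₂_same.2 fun e he => ?_)
    have h := p.edges_subset_edgeSet he
    exact ⟨h, by simp [ofEdgeOrder, hlab e h]⟩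
  · rw [List.pairwise_map]
    refine hpw.imp_of_mem fun {e e'} he he' hlt => ?_
    have h := p.edges_subset_edgeSet he
    have h' := p.edges_subset_edgeSet he'
    rw [hlab e h, hlab e' h', add_lt_add_iff_right, Nat.cast_lt]
    exact hσ ⟨e, h⟩ ⟨e', h'⟩ hlt
  · intro s hs
    obtain ⟨e, he, rfl⟩ := List.mem_map.1 hs
    have h := p.edges_subset_edgeSet he
    rw [hlab e h]
    exact_mod_cast (σ ⟨e, h⟩).is_lt

/-- If backward exploration from every set `U` with `|U| = |V| - 2 k + 1`, `k ≥ 1`, covers more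
than `|V| - k` vertices, then the doubling time is finite. -/
theorem double_lt_top_of_revReach (Y : Sym2 V → Fin (N + 1))
    (σ : EdgeOrder (slotGraph Y)) (hσ : Refines (fun e : (slotGraph Y).edgeSet => Y e) σ)
    (h : ∀ k, 1 ≤ k → 2 * k ≤ Fintype.card V → ∀ U : Finset V,
      U.card = Fintype.card V - 2 * k + 1 → Fintype.card V - k < (revReach Y N U).card) :
    (ofEdgeOrder (slotGraph Y) σ).double < ⊤ := by
  set H := ofEdgeOrder (slotGraph Y) σ
  set T := Nat.card (slotGraph Y).edgeSet
  refine lt_of_le_of_lt (b := (T : ℕ∞)) (iSup₂_le fun S hS => ?_) (ENat.natCast_lt_top T)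
  rw [Nat.card_eq_fintype_card] at hS
  refine iInf₂_le T ?_
  by_contra hlt
  have hk : 1 ≤ S.card := by omega
  classical
  have hcard : Fintype.card V - 2 * S.card + 1 ≤ (H.ball S T)ᶜ.toFinset.card := by
    have h1 := Set.ncard_add_ncard_compl (H.ball S T)
    rw [Set.ncard_eq_toFinset_card' (H.ball S T)ᶜ, Nat.card_eq_fintype_card] at h1
    omega
  obtain ⟨U, hU, hUc⟩ := Finset.exists_subset_card_eq hcard
  have hrev := h S.card hk hS U hUc
  have hdisj : Disjoint (revReach Y N U) S := by
    rw [Finset.disjoint_left]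
    intro w hw hwS
    obtain ⟨v, hv, hr⟩ := exists_reaches_of_mem_revReach Y σ hσ U w hw
    have := hU hv
    rw [Set.mem_toFinset] at this
    exact this ⟨w, hwS, hr⟩
  have := Finset.card_le_univ (revReach Y N U ∪ S)
  rw [Finset.card_union_of_disjoint hdisj] at this
  omega

end Explore

section Condition

variable {E κ : Type*} [DecidableEq E] [DecidableEq κ]

/-- The weight `w` restricted to the event that, among the coordinates in `D`, exactly those in
`C` take the value `k`. -/
def restrictWeight (w : E → κ → ℝ) (D C : Finset E) (k : κ) (e : E) (s : κ) : ℝ :=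
  if e ∈ D ∧ (e ∈ C ↔ s ≠ k) then 0 else w e s

theorem restrictWeight_nonneg {w : E → κ → ℝ} (hw : ∀ e s, 0 ≤ w e s) (D C : Finset E) (k : κ)
    (e : E) (s : κ) : 0 ≤ restrictWeight w D C k e s := by
  unfold restrictWeight
  split_ifs
  · exact le_rfl
  · exact hw e s

theorem restrictWeight_le {w : E → κ → ℝ} (hw : ∀ e s, 0 ≤ w e s) (D C : Finset E) (k : κ)
    (e : E) (s : κ) : restrictWeight w D C k e s ≤ w e s := by
  unfold restrictWeight
  split_ifs
  · exact hw e s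
  · exact le_rfl

variable [Fintype E] [Fintype κ]

theorem expect_eq_sum_restrictWeight (w : E → κ → ℝ) (D : Finset E) (k : κ) (f : (E → κ) → ℝ) :
    expect w f = ∑ C ∈ D.powerset, expect (restrictWeight w D C k) f := by
  unfold expect
  rw [Finset.sum_comm]
  refine Finset.sum_congr rfl fun Y _ => ?_
  rw [Finset.sum_eq_single (D.filter fun e => Y e = k)]
  · congr 1
    refine Finset.prod_congr rfl fun e _ => ?_
    unfold restrictWeight
    rw [if_neg]
    simp only [Finset.mem_filter]
    tauto
  · intro C hC hne
    have : ∃ e ∈ D, (e ∈ C ↔ Y e ≠ k) := by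
      by_contra hcon
      push Not at hcon
      refine hne (Finset.ext fun e => ?_)
      rw [Finset.mem_filter]
      by_cases he : e ∈ D
      · have := hcon e he
        tauto
      · have := fun h => he (Finset.mem_powerset.1 hC h)
        tauto
    obtain ⟨e, he, hiff⟩ := this
    rw [Finset.prod_eq_zero (Finset.mem_univ e), zero_mul]
    exact if_pos ⟨he, hiff⟩
  · intro h
    exact absurd (Finset.mem_powerset.2 (Finset.filter_subset _ _)) h

theorem prod_sum_restrictWeight_empty_le {w : E → κ → ℝ} (hw : ∀ e s, 0 ≤ w e s) (D : Finset E)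
    (k : κ) {q : ℝ} (hq : ∀ e ∈ D, q * ∑ s, w e s ≤ w e k) :
    ∏ e, ∑ s, restrictWeight w D ∅ k e s ≤ (1 - q) ^ D.card * ∏ e, ∑ s, w e s := by
  have hprod : (1 - q) ^ D.card * ∏ e, ∑ s, w e s =
      ∏ e, (if e ∈ D then 1 - q else 1) * ∑ s, w e s := by
    rw [Finset.prod_mul_distrib]
    congr 1
    rw [Finset.prod_ite_mem, Finset.univ_inter, Finset.prod_const]
  rw [hprod]
  refine Finset.prod_le_prod
    (fun e _ => Finset.sum_nonneg fun s _ => restrictWeight_nonneg hw D ∅ k e s) fun e _ => ?_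
  split_ifs with he
  · have h1 : ∑ s, restrictWeight w D ∅ k e s = ∑ s, w e s - w e k := by
      rw [eq_sub_iff_add_eq, ← Finset.sum_erase_add _ _ (Finset.mem_univ k),
        ← Finset.sum_erase_add (a := k) _ (fun s => w e s) (Finset.mem_univ k)]
      have h2 : restrictWeight w D ∅ k e k = 0 := by simp [restrictWeight, he]
      rw [h2, add_zero]
      congr 1
      refine Finset.sum_congr rfl fun s hs => ?_
      have := Finset.ne_of_mem_erase hs
      simp [restrictWeight, this]
    rw [h1]
    have := hq e he
    linarith
  · rw [one_mul]
    exact Finset.sum_le_sum fun s _ => restrictWeight_le hw D ∅ k e s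

end Condition

section ExploreProb

variable {V : Type*} [Fintype V] [DecidableEq V] {N : ℕ}

/-- The pairs with exactly one end in `U`. -/
def crossing (U : Finset V) : Finset (Sym2 V) :=
  (U ×ˢ Uᶜ).image fun x => s(x.1, x.2)

theorem mem_crossing {U : Finset V} {u v : V} (hv : v ∉ U) : s(v, u) ∈ crossing U ↔ u ∈ U := by
  simp only [crossing, Finset.mem_image, Finset.mem_product, Finset.mem_compl, Prod.exists,
    Sym2.eq_iff]
  constructor
  · rintro ⟨a, b, ⟨ha, hb⟩, ⟨rfl, rfl⟩ | ⟨rfl, rfl⟩⟩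
    · exact absurd ha hv
    · exact ha
  · exact fun h => ⟨u, v, ⟨h, hv⟩, .inr ⟨rfl, rfl⟩⟩

theorem exists_of_mem_crossing {U : Finset V} {e : Sym2 V} (he : e ∈ crossing U) :
    ∃ v ∉ U, ∃ u ∈ U, e = s(v, u) := by
  simp only [crossing, Finset.mem_image, Finset.mem_product, Finset.mem_compl, Prod.exists] at he
  obtain ⟨a, b, ⟨ha, hb⟩, rfl⟩ := he
  exact ⟨b, hb, a, ha, Sym2.eq_swap⟩

theorem card_crossing (U : Finset V) :
    (crossing U).card = U.card * (Fintype.card V - U.card) := by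
  rw [crossing, Finset.card_image_of_injOn, Finset.card_product, Finset.card_compl]
  rintro ⟨a, b⟩ hab ⟨c, d⟩ hcd h
  simp only [Finset.coe_product, Set.mem_prod, Finset.mem_coe, Finset.mem_compl] at hab hcd
  rw [Sym2.eq_iff] at h
  obtain ⟨rfl, rfl⟩ | ⟨rfl, rfl⟩ := h
  · rfl
  · exact absurd hab.1 hcd.2

/-- The set `U` together with the ends of the pairs of `C` that meet `U`. -/
def extend (U : Finset V) (C : Finset (Sym2 V)) : Finset V :=
  Finset.univ.filter fun v => v ∈ U ∨ ∃ u ∈ U, s(v, u) ∈ C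

theorem subset_extend (U : Finset V) (C : Finset (Sym2 V)) : U ⊆ extend U C :=
  fun v hv => by simp [extend, hv]

theorem card_lt_card_extend {U : Finset V} {C : Finset (Sym2 V)} (hC : C ⊆ crossing U)
    (hne : C.Nonempty) : U.card < (extend U C).card := by
  obtain ⟨e, he⟩ := hne
  obtain ⟨v, hv, u, hu, rfl⟩ := exists_of_mem_crossing (hC he)
  refine Finset.card_lt_card ((Finset.ssubset_iff_of_subset (subset_extend U C)).2 ⟨v, ?_, hv⟩)
  simp only [extend, Finset.mem_filter, Finset.mem_univ, true_and]
  exact .inr ⟨u, hu, he⟩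

/-- A potential-function bound for the probability that backward exploration fails to reach more
than `r` vertices: every pair that can still extend the explored set carries each remaining slot
with (conditional) probability at least `q`. -/
theorem expect_revReach_le {q ρ : ℝ} {a : ℕ → ℝ} {m r : ℕ} (hρ : 0 ≤ ρ)
    (ha0 : ∀ j, 0 ≤ a j) (ha1 : ∀ j, m ≤ j → j ≤ r → 1 ≤ a j)
    (hanti : ∀ j, m ≤ j → a (j + 1) ≤ a j)
    (hstep : ∀ j, m ≤ j → a (j + 1) + (a j - a (j + 1)) * (1 - q) ^ (j * (Fintype.card V - j)) ≤
      ρ * a j)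
    (i : ℕ) (hi : i ≤ N) (U : Finset V) (hU : m ≤ U.card)
    (w : Sym2 V → Fin (N + 1) → ℝ) (hw : ∀ e s, 0 ≤ w e s)
    (hq : ∀ u v, u ∉ U → u ≠ v → ∀ s : Fin (N + 1), (s : ℕ) < i →
      q * ∑ t, w s(u, v) t ≤ w s(u, v) s) :
    expect w (fun Y => if (revReach Y i U).card ≤ r then 1 else 0) ≤
      a U.card * ρ ^ i * ∏ e, ∑ s, w e s := by
  have hmono : ∀ j j', m ≤ j → j ≤ j' → a j' ≤ a j := by
    intro j j' hm hj
    induction j', hj using Nat.le_induction with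
    | base => exact le_rfl
    | succ l hl ih => exact (hanti l (hm.trans hl)).trans ih
  have hZ : ∀ w : Sym2 V → Fin (N + 1) → ℝ, (∀ e s, 0 ≤ w e s) → 0 ≤ ∏ e, ∑ s, w e s :=
    fun w hw => Finset.prod_nonneg fun e _ => Finset.sum_nonneg fun s _ => hw e s
  induction i generalizing U w with
  | zero =>
    simp only [revReach, pow_zero, mul_one]
    by_cases h : U.card ≤ r
    · simp only [h, if_true]
      rw [expect_one]
      exact le_mul_of_one_le_left (hZ w hw) (ha1 _ hU h)
    · simp only [h, if_false]
      have : expect w (fun _ => 0) = 0 := by simp [expect]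
      rw [this]
      exact mul_nonneg (ha0 _) (hZ w hw)
  | succ i ih =>
    let k : Fin (N + 1) := ⟨i, by omega⟩
    set D := crossing U with hD
    set Z := ∏ e, ∑ s, w e s with hZdef
    let Zc : Finset (Sym2 V) → ℝ := fun C => ∏ e, ∑ s, restrictWeight w D C k e s
    have hZc : ∀ C, 0 ≤ Zc C := fun C => hZ _ (restrictWeight_nonneg hw D C k)
    have hsum : ∑ C ∈ D.powerset, Zc C = Z := by
      have := expect_eq_sum_restrictWeight w D k (fun _ => 1)
      simp only [expect_one] at this
      exact this.symm
    have hterm : ∀ C ∈ D.powerset, expect (restrictWeight w D C k)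
        (fun Y => if (revReach Y (i + 1) U).card ≤ r then 1 else 0) ≤
          a (extend U C).card * ρ ^ i * Zc C := by
      intro C hC
      rw [Finset.mem_powerset] at hC
      have hcongr : expect (restrictWeight w D C k)
          (fun Y => if (revReach Y (i + 1) U).card ≤ r then 1 else 0) =
          expect (restrictWeight w D C k)
          (fun Y => if (revReach Y i (extend U C)).card ≤ r then 1 else 0) := by
        refine expect_congr_of_ne_zero fun Y hY => ?_
        have : slotStep Y i U = extend U C := by
          ext v
          simp only [slotStep, extend, Finset.mem_filter, Finset.mem_univ, true_and]
          by_cases hv : v ∈ U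
          · simp [hv]
          simp only [hv, false_or]
          refine exists_congr fun u => and_congr_right fun hu => ?_
          have h1 : s(v, u) ∈ D := (mem_crossing hv).2 hu
          have h2 := hY s(v, u)
          simp only [restrictWeight, h1, true_and, ne_eq, ite_eq_left_iff, not_forall] at h2
          have h3 := h2.1
          have h4 : (Y s(v, u) : ℕ) = i ↔ Y s(v, u) = k := by rw [Fin.ext_iff]
          rw [h4]
          tauto
        simp only [revReach, this]
      rw [hcongr]
      refine ih (by omega) _ (hU.trans (Finset.card_le_card (subset_extend U C))) _
        (restrictWeight_nonneg hw D C k) fun u v hu huv s hs => ?_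
      have huU : u ∉ U := fun h => hu (subset_extend U C h)
      have hnC : s(u, v) ∉ C := by
        intro h
        refine hu ?_
        simp only [extend, Finset.mem_filter, Finset.mem_univ, true_and]
        exact .inr ⟨v, (mem_crossing huU).1 (hC h), h⟩
      have hsk : s ≠ k := by
        rintro rfl
        exact lt_irrefl _ hs
      have hval : restrictWeight w D C k s(u, v) s = w s(u, v) s := by
        simp [restrictWeight, hnC, hsk]
      rw [hval]
      rcases le_or_gt 0 q with hq0 | hq0
      · refine le_trans ?_ (hq u v huU huv s (by omega))
        gcongr
        exact restrictWeight_le hw D C k _ _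
      · exact (mul_nonpos_of_nonpos_of_nonneg hq0.le
          (Finset.sum_nonneg fun t _ => restrictWeight_nonneg hw D C k _ t)).trans (hw _ _)
    have hempty : Zc ∅ ≤ (1 - q) ^ (U.card * (Fintype.card V - U.card)) * Z := by
      rw [← card_crossing]
      refine prod_sum_restrictWeight_empty_le hw D k fun e he => ?_
      obtain ⟨v, hv, u, hu, rfl⟩ := exists_of_mem_crossing he
      exact hq v u hv (by rintro rfl; exact hv hu) k (by simp [k])
    have hmem : ∅ ∈ D.powerset := Finset.empty_mem_powerset D
    have hext : extend U ∅ = U := by ext v; simp [extend]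
    have hZn : 0 ≤ Z := hZ w hw
    calc expect w (fun Y => if (revReach Y (i + 1) U).card ≤ r then 1 else 0)
        ≤ ∑ C ∈ D.powerset, a (extend U C).card * ρ ^ i * Zc C := by
          rw [expect_eq_sum_restrictWeight w D k]
          exact Finset.sum_le_sum hterm
      _ ≤ a U.card * ρ ^ i * Zc ∅ + ∑ C ∈ D.powerset.erase ∅, a (U.card + 1) * ρ ^ i * Zc C := by
          rw [← Finset.add_sum_erase _ _ hmem, hext]
          gcongr with C hC
          · exact hZc C
          · have hC' := Finset.mem_erase.1 hC
            exact hmono _ _ (by omega) (card_lt_card_extend (Finset.mem_powerset.1 hC'.2)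
              (Finset.nonempty_iff_ne_empty.2 hC'.1))
      _ = ρ ^ i * (a (U.card + 1) * Z + (a U.card - a (U.card + 1)) * Zc ∅) := by
          rw [← Finset.mul_sum, ← hsum, ← Finset.add_sum_erase _ _ hmem]
          ring
      _ ≤ ρ ^ i * (a (U.card + 1) * Z + (a U.card - a (U.card + 1)) *
            ((1 - q) ^ (U.card * (Fintype.card V - U.card)) * Z)) := by
          have := sub_nonneg.2 (hanti _ hU)
          gcongr
      _ = ρ ^ i * ((a (U.card + 1) + (a U.card - a (U.card + 1)) *
            (1 - q) ^ (U.card * (Fintype.card V - U.card))) * Z) := by ring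
      _ ≤ ρ ^ i * ((ρ * a U.card) * Z) := by
          have := hstep _ hU
          gcongr
      _ = a U.card * ρ ^ (i + 1) * Z := by ring

end ExploreProb

/-! ### Estimates for backward exploration -/

theorem one_sub_pow_le_one_sub_mul {q : ℝ} (h1 : q ≤ 1) (L : ℕ) {ε : ℝ} (hε : q * L ≤ ε)
    (h0 : 0 ≤ q) : (1 - q) ^ L ≤ 1 - (1 - ε) * (q * L) := by
  have hy : 0 ≤ q * L := by positivity
  have h2 : (1 - q) ^ L ≤ Real.exp (-(q * L)) := by
    have h3 : 1 - q ≤ Real.exp (-q) := Real.one_sub_le_exp_neg q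
    calc (1 - q) ^ L ≤ Real.exp (-q) ^ L := pow_le_pow_left₀ (by linarith) h3 L
      _ = Real.exp (-(q * L)) := by rw [← Real.exp_nat_mul]; congr 1; ring
  have h4 : Real.exp (-(q * L)) ≤ (1 + q * L)⁻¹ := by
    rw [Real.exp_neg]
    exact inv_anti₀ (by linarith) (by linarith [Real.add_one_le_exp (q * L)])
  have h5 : (1 + q * L)⁻¹ ≤ 1 - (1 - ε) * (q * L) := by
    rw [inv_le_iff_one_le_mul₀ (by linarith)]
    nlinarith [mul_nonneg hy hy, mul_le_mul_of_nonneg_left hε hy, mul_nonneg hy (mul_nonneg hy hy)]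
  exact h2.trans (h4.trans h5)

theorem sum_Ico_one_div_sub_le {x : ℝ} {m R : ℕ} (hx : x < m) (hR : m ≤ R) :
    ∑ l ∈ Finset.Ico m (R + 1), 1 / ((l : ℝ) - x) ≤
      1 / ((m : ℝ) - x) + (Real.log (R - x) - Real.log (m - x)) := by
  induction R, hR using Nat.le_induction with
  | base => simp
  | succ R hR ih =>
    rw [Finset.sum_Ico_succ_top (by omega)]
    have hRx : (0 : ℝ) < R - x := by
      have : (m : ℝ) ≤ R := by exact_mod_cast hR
      linarith
    have key : 1 / (((R + 1 : ℕ) : ℝ) - x) ≤ Real.log ((R + 1 : ℕ) - x) - Real.log (R - x) := by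
      have hpos : (0 : ℝ) < ((R + 1 : ℕ) : ℝ) - x := by push_cast; linarith
      have := Real.one_sub_inv_le_log_of_pos (div_pos hpos hRx)
      rw [Real.log_div hpos.ne' hRx.ne'] at this
      refine le_trans (le_of_eq ?_) this
      rw [inv_div]
      field_simp
      push_cast
      ring
    linarith

theorem sum_Ico_div_sub_le {ε x : ℝ} (hε : 0 < ε) (hx0 : 0 ≤ x) {m r n : ℕ}
    (hm : 1 ≤ m) (hmx : ε * m ≤ m - x) (hmr : m ≤ r) (hrn : r ≤ n) :
    ∑ l ∈ Finset.Ico m r, x / ((l : ℝ) - x) ≤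
      1 / ε + x * (Real.log n - Real.log (ε * m)) := by
  have hm' : (1 : ℝ) ≤ m := by exact_mod_cast hm
  have hmp : 0 < ε * m := by positivity
  have hrn' : (r : ℝ) ≤ n := by exact_mod_cast hrn
  have hmr' : (m : ℝ) ≤ r := by exact_mod_cast hmr
  rcases hmr.eq_or_lt with h | h
  · rw [← h]
    simp only [Finset.Ico_self, Finset.sum_empty]
    have h1 : Real.log (ε * m) ≤ Real.log n := Real.log_le_log hmp (by linarith)
    have h2 := mul_nonneg hx0 (sub_nonneg.2 h1)
    positivity
  · obtain ⟨R, hR⟩ : ∃ R, r = R + 1 := ⟨r - 1, by omega⟩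
    have h1 := sum_Ico_one_div_sub_le (x := x) (by linarith) (show m ≤ R by omega)
    rw [← hR] at h1
    have hRm : (m : ℝ) ≤ R := by exact_mod_cast (show m ≤ R by omega)
    have hRr : (R : ℝ) + 1 = r := by rw [hR]; push_cast; ring
    have h2 : Real.log (R - x) ≤ Real.log n := Real.log_le_log (by linarith) (by linarith)
    have h3 : Real.log (ε * m) ≤ Real.log (m - x) := Real.log_le_log hmp hmx
    have h4 : x * (1 / ((m : ℝ) - x)) ≤ 1 / ε := by
      rw [mul_one_div, div_le_div_iff₀ (by linarith) hε]
      have : x * ε ≤ m * ε := mul_le_mul_of_nonneg_right (by linarith) hε.le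
      linarith
    calc ∑ l ∈ Finset.Ico m r, x / ((l : ℝ) - x)
        = x * ∑ l ∈ Finset.Ico m r, 1 / ((l : ℝ) - x) := by
          rw [Finset.mul_sum]; exact Finset.sum_congr rfl fun l _ => by ring
      _ ≤ x * (1 / ((m : ℝ) - x) + (Real.log (R - x) - Real.log (m - x))) := by gcongr
      _ = x * (1 / ((m : ℝ) - x)) + x * (Real.log (R - x) - Real.log (m - x)) := by ring
      _ ≤ 1 / ε + x * (Real.log n - Real.log (ε * m)) := by gcongr

variable {V : Type*} [Fintype V] [DecidableEq V] {N : ℕ}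

/-- The probability that backward exploration from a set of `m = n - 2 k + 1` vertices covers at
most `n - k` vertices. -/
theorem expect_revReach_le_exp {n k m : ℕ} (hn : Fintype.card V = n) (hk : 1 ≤ k)
    (hkn : 2 * k ≤ n) (hm : m = n - 2 * k + 1) {ε q x : ℝ} (hε : 0 < ε) (hε1 : ε < 1)
    (hx0 : 0 ≤ x) (hxm : x ≤ (1 - ε) * m) (hxk : x ≤ (1 - ε) * k)
    (hq0 : 0 ≤ q) (hqn : q * (n : ℝ) ^ 2 ≤ ε)
    (w : Sym2 V → Fin (N + 1) → ℝ) (hw : ∀ e s, 0 ≤ w e s) (hw1 : ∀ e, ∑ s, w e s = 1)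
    (hq : ∀ u v, u ≠ v → ∀ s : Fin (N + 1), (s : ℕ) < N → q ≤ w s(u, v) s)
    (U : Finset V) (hU : U.card = m) :
    expect w (fun Y => if (revReach Y N U).card ≤ n - k then 1 else 0) ≤
      Real.exp (1 / ε + x / ε + x * (Real.log n - Real.log (ε * m)) -
        (1 - ε) * (q * N) * (x * (n - x))) := by
  have hk' : (1 : ℝ) ≤ k := by exact_mod_cast hk
  have hm1 : 1 ≤ m := by omega
  have hm' : (1 : ℝ) ≤ m := by exact_mod_cast hm1
  have hkn' : (2 : ℝ) * k ≤ n := by exact_mod_cast hkn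
  have hmR : (m : ℝ) = n - 2 * k + 1 := by
    rw [hm]; push_cast [Nat.cast_sub hkn]; ring
  have hmx : ε * m ≤ m - x := by nlinarith
  have hkx : ε * k ≤ k - x := by nlinarith
  have hxm' : x < m := by nlinarith
  have hxk' : x < k := by nlinarith
  have hn1 : (2 : ℝ) ≤ n := by linarith
  have hqle : q ≤ 1 := by nlinarith
  have hnx : 0 ≤ n - x := by linarith
  set r := n - k with hr
  have hrR : (r : ℝ) = n - k := by rw [hr, Nat.cast_sub (by omega)]
  set θ := (1 - ε) * (q * (x * (n - x))) with hθ
  set b : ℕ → ℝ := fun l => x / (l - x) + x / (n - l - x) with hb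
  set a : ℕ → ℝ := fun j => if j ≤ r then Real.exp (∑ l ∈ Finset.Ico j r, b l) else 0 with ha
  have hbounds : ∀ l, m ≤ l → l ≤ r → x < l ∧ x < n - l := by
    intro l h1 h2
    have h1' : (m : ℝ) ≤ l := by exact_mod_cast h1
    have h2' : (l : ℝ) ≤ r := by exact_mod_cast h2
    constructor <;> linarith
  have hb0 : ∀ l, m ≤ l → l ≤ r → 0 ≤ b l := by
    intro l h1 h2
    obtain ⟨h3, h4⟩ := hbounds l h1 h2
    exact add_nonneg (div_nonneg hx0 (by linarith)) (div_nonneg hx0 (by linarith))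
  have hpowle : ∀ l, l ≤ n → (1 - q) ^ (l * (n - l)) ≤ 1 - (1 - ε) * (q * (l * (n - l))) := by
    intro l hl
    have h1 : ((l * (n - l) : ℕ) : ℝ) = l * (n - l) := by push_cast [Nat.cast_sub hl]; ring
    have := one_sub_pow_le_one_sub_mul hqle (l * (n - l)) (ε := ε) ?_ hq0
    · rwa [h1] at this
    · refine le_trans (mul_le_mul_of_nonneg_left ?_ hq0) hqn
      rw [h1]
      have : (l : ℝ) ≤ n := by exact_mod_cast hl
      nlinarith [Nat.cast_nonneg (α := ℝ) l]
  have hprod : ∀ l, m ≤ l → l ≤ r → x * (n - x) ≤ l * (n - l) := by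
    intro l h1 h2
    obtain ⟨h3, h4⟩ := hbounds l h1 h2
    nlinarith [mul_nonneg (sub_nonneg.2 h3.le) (sub_nonneg.2 h4.le)]
  have hmr : m ≤ r := by omega
  have hθr : (1 - q) ^ (r * (n - r)) ≤ 1 - θ := by
    refine (hpowle r (by omega)).trans ?_
    have := hprod r hmr le_rfl
    rw [hθ]
    have h2 := mul_le_mul_of_nonneg_left this hq0
    have h3 := mul_le_mul_of_nonneg_left h2 (by linarith : (0 : ℝ) ≤ 1 - ε)
    linarith
  have hρ : 0 ≤ 1 - θ := (pow_nonneg (by linarith) _).trans hθr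
  have hpot := expect_revReach_le (V := V) (N := N) (q := q) (ρ := 1 - θ) (a := a) (m := m) (r := r)
    hρ (fun j => by simp only [ha]; split_ifs <;> positivity)
    (fun j h1 h2 => by
      simp only [ha, if_pos h2]
      refine Real.one_le_exp (Finset.sum_nonneg fun l hl => ?_)
      obtain ⟨h3, h4⟩ := Finset.mem_Ico.1 hl
      exact hb0 l (h1.trans h3) h4.le)
    (fun j h1 => by
      simp only [ha]
      by_cases h2 : j + 1 ≤ r
      · rw [if_pos h2, if_pos (by omega), Finset.sum_eq_sum_Ico_succ_bot (show j < r by omega)]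
        exact Real.exp_le_exp.2 (le_add_of_nonneg_left (hb0 j h1 (by omega)))
      · rw [if_neg h2]
        split_ifs <;> positivity)
    (fun j h1 => by
      rw [hn]
      rcases lt_trichotomy j r with h2 | h2 | h2
      · have hstep : a (j + 1) ≤ (1 - x * (n - x) / (j * (n - j))) * a j := by
          simp only [ha]
          rw [if_pos (by omega), if_pos (by omega), Finset.sum_eq_sum_Ico_succ_bot h2, Real.exp_add,
            ← mul_assoc]
          refine le_mul_of_one_le_left (Real.exp_nonneg _) ?_
          obtain ⟨h3, h4⟩ := hbounds j h1 h2.le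
          have e1 : x / (j - x) + 1 ≤ Real.exp (x / (j - x)) := Real.add_one_le_exp _
          have e2 : x / (n - j - x) + 1 ≤ Real.exp (x / (n - j - x)) := Real.add_one_le_exp _
          have p1 : 0 < (j : ℝ) - x := by linarith
          have p2 : 0 < (n : ℝ) - j - x := by linarith
          have p3 : 0 < (j : ℝ) := by linarith
          have p4 : 0 < (n : ℝ) - j := by linarith
          have e3 : 1 - x * (n - x) / (j * (n - j)) =
              ((x / (j - x) + 1) * (x / (n - j - x) + 1))⁻¹ := by
            field_simp
            ring
          rw [e3, Real.exp_add, inv_mul_eq_div, one_le_div (by positivity)]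
          exact mul_le_mul e1 e2 (by positivity) (Real.exp_nonneg _)
        obtain ⟨h3, h4⟩ := hbounds j h1 h2.le
        have p3 : 0 < (j : ℝ) := by linarith
        have p4 : 0 < (n : ℝ) - j := by linarith
        have haj : 0 ≤ a j := by simp only [ha]; split_ifs <;> positivity
        set P := (1 - q) ^ (j * (n - j)) with hP
        have hPle := hpowle j (by omega)
        have hP0 : 0 ≤ 1 - P := sub_nonneg.2 (pow_le_one₀ (by linarith) (by linarith))
        set t := x * (n - x) / (j * (n - j)) with ht
        have ht0 : 0 ≤ t := by positivity
        have htθ : θ ≤ t * (1 - P) := by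
          have : t * ((1 - ε) * (q * (j * (n - j)))) = θ := by
            rw [ht, hθ]; field_simp
          rw [← this]
          exact mul_le_mul_of_nonneg_left (by linarith) ht0
        calc a (j + 1) + (a j - a (j + 1)) * P = a j * P + a (j + 1) * (1 - P) := by ring
          _ ≤ a j * P + ((1 - t) * a j) * (1 - P) := by gcongr
          _ = (1 - t * (1 - P)) * a j := by ring
          _ ≤ (1 - θ) * a j := by gcongr
      · subst h2
        simp only [ha]
        simpa using hθr
      · simp only [ha]
        rw [if_neg (by omega), if_neg (by omega)]
        simp)
    N le_rfl U hU.ge w hw (fun u v _ huv s hs => by rw [hw1, mul_one]; exact hq u v huv s hs)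
  refine hpot.trans ?_
  rw [hU, Finset.prod_eq_one fun e _ => hw1 e, mul_one]
  have hpow : (1 - θ) ^ N ≤ Real.exp (-(θ * N)) := by
    calc (1 - θ) ^ N ≤ Real.exp (-θ) ^ N :=
          pow_le_pow_left₀ hρ (Real.one_sub_le_exp_neg θ) N
      _ = _ := by rw [← Real.exp_nat_mul]; congr 1; ring
  have ham : a m = Real.exp (∑ l ∈ Finset.Ico m r, b l) := if_pos hmr
  have hsum2 : ∑ l ∈ Finset.Ico m r, x / ((n : ℝ) - l - x) ≤ x / ε := by
    have h1 : ∀ l ∈ Finset.Ico m r, x / ((n : ℝ) - l - x) ≤ x / (ε * k) := by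
      intro l hl
      obtain ⟨-, h2⟩ := Finset.mem_Ico.1 hl
      have h2' : (l : ℝ) ≤ r := by exact_mod_cast h2.le
      exact div_le_div_of_nonneg_left hx0 (by positivity) (by linarith)
    refine (Finset.sum_le_card_nsmul _ _ _ h1).trans ?_
    rw [Nat.card_Ico, nsmul_eq_mul]
    have h3 : ((r - m : ℕ) : ℝ) ≤ k := by exact_mod_cast (by omega)
    calc ((r - m : ℕ) : ℝ) * (x / (ε * k)) ≤ k * (x / (ε * k)) := by gcongr
      _ = x / ε := by field_simp
  have hsum1 : ∑ l ∈ Finset.Ico m r, x / ((l : ℝ) - x) ≤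
      1 / ε + x * (Real.log n - Real.log (ε * m)) :=
    sum_Ico_div_sub_le hε hx0 hm1 (by linarith) hmr (by omega)
  calc a m * (1 - θ) ^ N ≤ Real.exp (∑ l ∈ Finset.Ico m r, b l) * Real.exp (-(θ * N)) := by
        rw [ham]; gcongr
    _ = Real.exp (∑ l ∈ Finset.Ico m r, b l + -(θ * N)) := by rw [Real.exp_add]
    _ ≤ _ := by
      refine Real.exp_le_exp.2 ?_
      simp only [hb, Finset.sum_add_distrib]
      rw [hθ]
      linarith

/-- The cost of the union bound over the starting sets is absorbed by the exploration estimate. -/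
theorem choose_mul_exp_le {c ε : ℝ} (hc : 0 < c) (hc1 : c ≤ 1) (hε : ε = c / 24) {n k m : ℕ}
    (hk : 1 ≤ k) (hkn : 2 * k ≤ n) (hm : m = n - 2 * k + 1) :
    (n.choose m : ℝ) * Real.exp (1 / ε + (1 - ε) * (min m k : ℕ) / ε +
        (1 - ε) * (min m k : ℕ) * (Real.log n - Real.log (ε * m)) -
        (1 - ε) * ((2 + c) * (Real.log n / n)) *
          ((1 - ε) * (min m k : ℕ) * (n - (1 - ε) * (min m k : ℕ)))) ≤
      Real.exp (1 / ε) *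
        Real.exp (2 / ε + 2 * (-Real.log ε) - c / 2 * Real.log n) ^ (min m k : ℕ) := by
  have hε0 : 0 < ε := by rw [hε]; positivity
  have hε1 : ε ≤ 1 / 24 := by rw [hε]; linarith
  have hk' : (1 : ℝ) ≤ k := by exact_mod_cast hk
  have hm1 : 1 ≤ m := by omega
  have hm' : (1 : ℝ) ≤ m := by exact_mod_cast hm1
  have hkn' : (2 : ℝ) * k ≤ n := by exact_mod_cast hkn
  have hmR : (m : ℝ) = n - 2 * k + 1 := by
    rw [hm]; push_cast [Nat.cast_sub hkn]; ring
  have hn : (2 : ℝ) ≤ n := by linarith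
  have hn0 : (0 : ℝ) < n := by linarith
  have hL : 0 ≤ Real.log n := Real.log_nonneg (by linarith)
  have hlam : 0 ≤ -Real.log ε := by
    have := Real.log_nonpos hε0.le (by linarith)
    linarith
  have hlogm : Real.log (ε * m) = Real.log ε + Real.log m :=
    Real.log_mul hε0.ne' (by positivity)
  have hm0 : 0 ≤ Real.log m := Real.log_nonneg hm'
  have hexp : ∀ j : ℕ, (n : ℝ) ^ j = Real.exp (j * Real.log n) := by
    intro j
    rw [Real.exp_nat_mul, Real.exp_log hn0]
  set L := Real.log n with hLdef
  set μ := min m k with hμ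
  have hμm : (μ : ℝ) ≤ m := by exact_mod_cast min_le_left _ _
  have hμk : (μ : ℝ) ≤ k := by exact_mod_cast min_le_right _ _
  have hμ0 : (0 : ℝ) ≤ μ := Nat.cast_nonneg _
  set x := (1 - ε) * (μ : ℝ) with hx
  have hx0 : 0 ≤ x := mul_nonneg (by linarith) hμ0
  have hxμ : x ≤ μ := by rw [hx]; nlinarith
  rw [← Real.exp_nat_mul, ← Real.exp_add]
  suffices h : ∃ B : ℝ, (n.choose m : ℝ) ≤ Real.exp B ∧
      B + x / ε + x * (L - Real.log (ε * m)) -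
        (1 - ε) * ((2 + c) * (L / n)) * (x * (n - x)) ≤
      μ * (2 / ε + 2 * (-Real.log ε) - c / 2 * L) by
    obtain ⟨B, hB, hle⟩ := h
    calc _ ≤ Real.exp B * Real.exp (1 / ε + x / ε + x * (L - Real.log (ε * m)) -
          (1 - ε) * ((2 + c) * (L / n)) * (x * (n - x))) := by gcongr
      _ ≤ _ := by
        rw [← Real.exp_add]
        exact Real.exp_le_exp.2 (by linarith)
  have hxε : x / ε ≤ μ * (1 / ε) := by rw [mul_one_div]; gcongr
  have hT : ∀ d : ℝ, 0 ≤ d → x ≤ (1 - d) * n →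
      (1 - ε) * (2 + c) * d * (L * x) ≤ (1 - ε) * ((2 + c) * (L / n)) * (x * (n - x)) := by
    intro d hd h
    have h1 : d ≤ (n - x) / n := by rw [le_div_iff₀ hn0]; linarith
    have h2 : (1 - ε) * ((2 + c) * (L / n)) * (x * (n - x)) =
        (1 - ε) * (2 + c) * ((n - x) / n) * (L * x) := by field_simp
    rw [h2]
    have : 0 ≤ 1 - ε := by linarith
    gcongr
  have hLμ : 0 ≤ L * μ := by positivity
  have hmain : (2 + c / 2) * (L * μ) ≤ (1 - ε) * (2 + c) * (1 - ε) * (L * x) := by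
    have h1 : 2 + c / 2 ≤ (1 - ε) * (2 + c) * (1 - ε) * (1 - ε) := by
      subst hε
      nlinarith [mul_pos hc hc, mul_pos (mul_pos hc hc) hc,
        mul_nonneg (mul_pos hc hc).le (sub_nonneg.2 hc1)]
    calc (2 + c / 2) * (L * μ) ≤ (1 - ε) * (2 + c) * (1 - ε) * (1 - ε) * (L * μ) := by gcongr
      _ = _ := by rw [hx]; ring
  have hlogle : x * (L - Real.log (ε * m)) ≤ μ * (L + -Real.log ε) := by
    rw [hlogm]
    calc x * (L - (Real.log ε + Real.log m)) ≤ x * (L + -Real.log ε) := by gcongr; linarith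
      _ ≤ _ := by gcongr
  have hlogle2 : ε * n ≤ m → x * (L - Real.log (ε * m)) ≤ μ * (2 * -Real.log ε) := by
    intro h
    have h1 : Real.log ε + L ≤ Real.log m := by
      rw [hLdef, ← Real.log_mul hε0.ne' hn0.ne']
      exact Real.log_le_log (by positivity) h
    rw [hlogm]
    calc x * (L - (Real.log ε + Real.log m)) ≤ x * (2 * -Real.log ε) := by gcongr; linarith
      _ ≤ _ := by gcongr
  have hμε : 0 ≤ (μ : ℝ) * (1 / ε) := by positivity
  have hμl : 0 ≤ (μ : ℝ) * -Real.log ε := by positivity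
  have hexpand : (μ : ℝ) * (2 / ε + 2 * (-Real.log ε) - c / 2 * L) =
      μ * (1 / ε) + μ * (1 / ε) + 2 * (μ * -Real.log ε) - c / 2 * (L * μ) := by ring
  rw [hexpand]
  have hmain' : 2 * (L * μ) + c / 2 * (L * μ) ≤ (1 - ε) * (2 + c) * (1 - ε) * (L * x) := by
    linarith
  rw [mul_add, mul_comm (μ : ℝ) L] at hlogle
  rw [mul_left_comm] at hlogle2
  set T := (1 - ε) * ((2 + c) * (L / n)) * (x * (n - x))
  set F := x * (L - Real.log (ε * m))
  have hεn : ε * n ≤ 1 / 24 * n := by gcongr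
  rcases le_or_gt (m : ℝ) (ε * n) with hA | hA
  · have hmk : (m : ℝ) ≤ k := by linarith
    have hμe : μ = m := min_eq_left (by exact_mod_cast hmk)
    refine ⟨L * m, ?_, ?_⟩
    · rw [mul_comm, ← hexp]
      exact_mod_cast Nat.choose_le_pow n m
    · have := hT (1 - ε) (by linarith) (by linarith)
      rw [show L * (m : ℝ) = L * μ by rw [hμe]]
      linarith
  rcases le_or_gt (k : ℝ) (ε * n) with hB | hB
  · have hmk : (k : ℝ) ≤ m := by linarith
    have hμe : μ = k := min_eq_right (by exact_mod_cast hmk)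
    refine ⟨(2 * k - 1 : ℕ) * L, ?_, ?_⟩
    · rw [← hexp]
      have h1 : n.choose m = n.choose (2 * k - 1) := by
        rw [← Nat.choose_symm (show m ≤ n by omega)]
        congr 1
        omega
      rw [h1]
      exact_mod_cast Nat.choose_le_pow n (2 * k - 1)
    · have h2 := hT (1 - ε) (by linarith) (by linarith)
      have h3 := hlogle2 hA.le
      have h4 : ((2 * k - 1 : ℕ) : ℝ) * L ≤ 2 * (L * μ) := by
        have : ((2 * k - 1 : ℕ) : ℝ) ≤ 2 * μ := by
          rw [hμe]
          exact_mod_cast (show 2 * k - 1 ≤ 2 * k by omega)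
        calc ((2 * k - 1 : ℕ) : ℝ) * L ≤ 2 * μ * L := by gcongr
          _ = _ := by ring
      linarith
  · refine ⟨n, ?_, ?_⟩
    · calc (n.choose m : ℝ) ≤ 2 ^ n := by exact_mod_cast Nat.choose_le_two_pow n m
        _ ≤ Real.exp 1 ^ n := by
          gcongr
          linarith [Real.add_one_le_exp (1 : ℝ)]
        _ = Real.exp n := by rw [← Real.exp_nat_mul, mul_one]
    · have h2 := hT (1 / 2) (by norm_num) (by linarith)
      have h3 := hlogle2 hA.le
      have h4 : (n : ℝ) ≤ μ * (1 / ε) := by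
        rw [mul_one_div, le_div_iff₀ hε0]
        rcases min_choice m k with h | h
        · rw [hμ, h]; linarith
        · rw [hμ, h]; linarith
      have h5 : c / 2 * (L * μ) ≤ (1 - ε) * (2 + c) * (1 / 2) * (L * x) := by
        have h6 : c / 2 ≤ (1 - ε) * (2 + c) * (1 / 2) * (1 - ε) := by
          have h7 : (23 / 24 : ℝ) * (23 / 24) ≤ (1 - ε) * (1 - ε) := by gcongr <;> linarith
          calc c / 2 ≤ (2 + c) / 2 * (23 / 24 * (23 / 24)) := by linarith
            _ ≤ (2 + c) / 2 * ((1 - ε) * (1 - ε)) := by gcongr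
            _ = _ := by ring
        calc c / 2 * (L * μ) ≤ (1 - ε) * (2 + c) * (1 / 2) * (1 - ε) * (L * μ) := by gcongr
          _ = _ := by rw [hx]; ring
      linarith

theorem sum_pow_le_two_mul {y : ℝ} (hy0 : 0 ≤ y) (hy : y ≤ 1 / 2) (s : Finset ℕ)
    (hs : ∀ j ∈ s, 1 ≤ j) : ∑ j ∈ s, y ^ j ≤ 2 * y := by
  have h1 : s ⊆ (Finset.range (s.sup id)).image Nat.succ := by
    intro j hj
    have := Finset.le_sup (f := id) hj
    have h2 := hs j hj
    simp only [id] at this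
    exact Finset.mem_image.2 ⟨j - 1, Finset.mem_range.2 (by omega), by omega⟩
  refine (Finset.sum_le_sum_of_subset_of_nonneg h1 fun j _ _ => by positivity).trans ?_
  rw [Finset.sum_image (by simp)]
  simp only [Nat.succ_eq_add_one, pow_succ, ← Finset.sum_mul]
  refine mul_le_mul_of_nonneg_right ?_ hy0
  have h2 := geom_sum_mul_neg y (s.sup id)
  have h3 : 0 ≤ y ^ (s.sup id) := by positivity
  have h4 : 0 ≤ ∑ i ∈ Finset.range (s.sup id), y ^ i := by positivity
  nlinarith

theorem sum_pow_min_le {y : ℝ} (hy0 : 0 ≤ y) (hy : y ≤ 1 / 2) (n : ℕ) :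
    ∑ k ∈ Finset.Icc 1 (n / 2), y ^ (min (n - 2 * k + 1) k) ≤ 4 * y := by
  calc ∑ k ∈ Finset.Icc 1 (n / 2), y ^ (min (n - 2 * k + 1) k)
      ≤ ∑ k ∈ Finset.Icc 1 (n / 2), (y ^ (n - 2 * k + 1) + y ^ k) := by
        refine Finset.sum_le_sum fun k _ => ?_
        have h1 : 0 ≤ y ^ (n - 2 * k + 1) := by positivity
        have h2 : 0 ≤ y ^ k := by positivity
        rcases min_choice (n - 2 * k + 1) k with h | h <;> rw [h] <;> linarith
    _ = ∑ j ∈ (Finset.Icc 1 (n / 2)).image (fun k => n - 2 * k + 1), y ^ j +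
        ∑ k ∈ Finset.Icc 1 (n / 2), y ^ k := by
        rw [Finset.sum_add_distrib, Finset.sum_image]
        intro a ha b hb hab
        simp only [Finset.coe_Icc, Set.mem_Icc] at ha hb
        simp only at hab
        omega
    _ ≤ 2 * y + 2 * y := by
        refine add_le_add (sum_pow_le_two_mul hy0 hy _ ?_) (sum_pow_le_two_mul hy0 hy _ ?_)
        · intro j hj
          obtain ⟨k, -, rfl⟩ := Finset.mem_image.1 hj
          omega
        · intro j hj
          exact (Finset.mem_Icc.1 hj).1
    _ = 4 * y := by ring

/-- A quantitative lower bound for the probability of a finite doubling time. -/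
theorem rstg_double_lt_top_ge {c ε : ℝ} (hc : 0 < c) (hc1 : c ≤ 1) (hε : ε = c / 24) {n : ℕ}
    (hn : 1 ≤ ε * n) (p : unitInterval) (hp : (2 + c) * (Real.log n / n) < p)
    (hy : Real.exp (2 / ε + 2 * (-Real.log ε) - c / 2 * Real.log n) ≤ 1 / 2) :
    ENNReal.ofReal (1 - Real.exp (1 / ε) *
        (4 * Real.exp (2 / ε + 2 * (-Real.log ε) - c / 2 * Real.log n))) ≤
      (rstg (Fin n) p).toMeasure {H | H.double < ⊤} := by
  classical
  set y := Real.exp (2 / ε + 2 * (-Real.log ε) - c / 2 * Real.log n) with hydef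
  have hε0 : 0 < ε := by rw [hε]; positivity
  have hε1 : ε ≤ 1 / 24 := by rw [hε]; linarith
  have hnpos : 0 < n := by
    rcases Nat.eq_zero_or_pos n with h | h
    · rw [h] at hn; norm_num at hn
    · exact h
  have hn1 : (1 : ℝ) ≤ n := by exact_mod_cast hnpos
  have hL : 0 ≤ Real.log n := Real.log_nonneg hn1
  set N := n ^ 3 with hN
  have hN0 : 0 < N := by positivity
  have hNR : (N : ℝ) = (n : ℝ) ^ 3 := by rw [hN]; push_cast; ring
  set q : ℝ := (2 + c) * (Real.log n / n) / N with hq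
  have hq0 : 0 ≤ q := by positivity
  have hp1 : (p : ℝ) ≤ 1 := p.2.2
  have hqn : q * (n : ℝ) ^ 2 ≤ ε := by
    rw [hq, hNR, div_mul_eq_mul_div, div_le_iff₀ (by positivity)]
    calc (2 + c) * (Real.log n / n) * (n : ℝ) ^ 2 ≤ 1 * (n : ℝ) ^ 2 := by gcongr; linarith
      _ ≤ (ε * n) * (n : ℝ) ^ 2 := by gcongr
      _ = _ := by ring
  have hqN : q * N = (2 + c) * (Real.log n / n) := by
    rw [hq]; field_simp
  set w : Sym2 (Fin n) → Fin (N + 1) → ℝ := slotWeight N p with hwdef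
  have hw : ∀ e s, 0 ≤ w e s := slotWeight_nonneg p.2.1 p.2.2
  have hw1 : ∀ e, ∑ s, w e s = 1 := sum_slotWeight hN0 p
  have hqw : ∀ u v, u ≠ v → ∀ s : Fin (N + 1), (s : ℕ) < N → q ≤ w s(u, v) s := by
    intro u v huv s hs
    simp only [hwdef, slotWeight, Sym2.mk_isDiag_iff, huv, if_false, hs, if_true]
    rw [hq]
    gcongr
  let fam : ℕ → Finset (Finset (Fin n)) := fun k =>
    Finset.powersetCard (n - 2 * k + 1) Finset.univ
  let S : Set (Sym2 (Fin n) → Fin (N + 1)) :=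
    {Y | ∀ k ∈ Finset.Icc 1 (n / 2), ∀ U ∈ fam k, n - k < (revReach Y N U).card}
  have hbad : ∑ k ∈ Finset.Icc 1 (n / 2), ∑ U ∈ fam k,
      expect w (fun Y => if (revReach Y N U).card ≤ n - k then 1 else 0) ≤
        Real.exp (1 / ε) * (4 * y) := by
    calc _ ≤ ∑ k ∈ Finset.Icc 1 (n / 2), Real.exp (1 / ε) * y ^ (min (n - 2 * k + 1) k) := by
          refine Finset.sum_le_sum fun k hk => ?_
          obtain ⟨hk1, hk2⟩ := Finset.mem_Icc.1 hk
          have hkn : 2 * k ≤ n := by omega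
          refine le_trans ?_ (choose_mul_exp_le hc hc1 hε hk1 hkn rfl)
          have hcard : (fam k).card = n.choose (n - 2 * k + 1) := by
            simp [fam]
          rw [← hcard, ← nsmul_eq_mul]
          refine Finset.sum_le_card_nsmul _ _ _ fun U hU => ?_
          rw [← hqN]
          refine expect_revReach_le_exp (by simp) hk1 hkn rfl hε0 (by linarith)
            (mul_nonneg (by linarith) (Nat.cast_nonneg _)) ?_ ?_ hq0 hqn w hw hw1 hqw U
            (Finset.mem_powersetCard.1 hU).2
          · refine mul_le_mul_of_nonneg_left ?_ (by linarith)
            exact_mod_cast min_le_left _ _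
          · refine mul_le_mul_of_nonneg_left ?_ (by linarith)
            exact_mod_cast min_le_right _ _
      _ = Real.exp (1 / ε) * ∑ k ∈ Finset.Icc 1 (n / 2), y ^ (min (n - 2 * k + 1) k) := by
          rw [Finset.mul_sum]
      _ ≤ _ := by
          gcongr
          exact sum_pow_min_le (Real.exp_nonneg _) hy n
  have hgood : 1 - Real.exp (1 / ε) * (4 * y) ≤ expect w (fun Y => if Y ∈ S then 1 else 0) := by
    have h1 : expect w (fun _ => 1) ≤ expect w (fun Y => (if Y ∈ S then 1 else 0) +
        ∑ k ∈ Finset.Icc 1 (n / 2), ∑ U ∈ fam k,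
          if (revReach Y N U).card ≤ n - k then 1 else 0) := by
      refine expect_mono hw fun Y => ?_
      by_cases hY : Y ∈ S
      · rw [if_pos hY]
        exact le_add_of_nonneg_right (Finset.sum_nonneg fun k _ => Finset.sum_nonneg fun U _ => by
          split_ifs <;> norm_num)
      · rw [if_neg hY, zero_add]
        simp only [S, Set.mem_ofPred_eq, not_forall, not_lt] at hY
        obtain ⟨k, hk, U, hU, hle⟩ := hY
        refine le_trans ?_ (Finset.single_le_sum (fun k _ => Finset.sum_nonneg fun U _ => by
          split_ifs <;> norm_num) hk)
        refine le_trans ?_ (Finset.single_le_sum (fun U _ => by split_ifs <;> norm_num) hU)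
        rw [if_pos hle]
    rw [expect_add, expect_sum, expect_one, Finset.prod_eq_one fun e _ => hw1 e] at h1
    simp only [expect_sum] at h1
    linarith
  refine (ENNReal.ofReal_le_ofReal hgood).trans ?_
  refine expect_slotWeight_le_rstg hN0 p S _ fun Y hY σ hσ => ?_
  refine double_lt_top_of_revReach Y σ hσ fun k hk1 hk2 U hU => ?_
  rw [Fintype.card_fin] at hk2 hU ⊢
  exact hY k (Finset.mem_Icc.2 ⟨hk1, by omega⟩) U
    (Finset.mem_powersetCard.2 ⟨Finset.subset_univ _, hU⟩)

theorem tendsto_rstg_double_lt_top (β : ℕ → unitInterval) {c : ℝ} (hc : 0 < c)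
    (hβ : ∀ᶠ n : ℕ in atTop, (2 + c) * (Real.log n / n) < (β n : ℝ)) :
    Tendsto (fun n : ℕ => (rstg (Fin n) (β n)).toMeasure {H | H.double < ⊤}) atTop (𝓝 1) := by
  set d := min c 1 with hd
  have hd0 : 0 < d := lt_min hc one_pos
  set ε := d / 24 with hε
  have hε0 : 0 < ε := by positivity
  have hlog : Tendsto (fun n : ℕ => Real.log n) atTop atTop :=
    Real.tendsto_log_atTop.comp tendsto_natCast_atTop_atTop
  have hy : Tendsto (fun n : ℕ => Real.exp (2 / ε + 2 * (-Real.log ε) - d / 2 * Real.log n)) atTop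
      (𝓝 0) := by
    refine Real.tendsto_exp_atBot.comp ?_
    simp only [sub_eq_add_neg]
    refine tendsto_atBot_add_const_left _ _ (tendsto_neg_atTop_atBot.comp ?_)
    exact hlog.const_mul_atTop (by positivity)
  have hlow : Tendsto (fun n : ℕ => ENNReal.ofReal (1 - Real.exp (1 / ε) *
      (4 * Real.exp (2 / ε + 2 * (-Real.log ε) - d / 2 * Real.log n)))) atTop (𝓝 1) := by
    have h1 := ENNReal.tendsto_ofReal (((hy.const_mul 4).const_mul (Real.exp (1 / ε))).const_sub 1)
    simpa using h1
  refine tendsto_of_tendsto_of_tendsto_of_le_of_le' hlow tendsto_const_nhds ?_ ?_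
  · filter_upwards [hβ, hy.eventually_le_const (show (0 : ℝ) < 1 / 2 by norm_num),
      tendsto_natCast_atTop_atTop.eventually_ge_atTop (1 / ε)] with n h1 h2 h3
    refine rstg_double_lt_top_ge hd0 (min_le_right _ _) hε ?_ _ (lt_of_le_of_lt ?_ h1) h2
    · rw [div_le_iff₀ hε0] at h3
      linarith
    · have : 0 ≤ Real.log n / n := div_nonneg (Real.log_natCast_nonneg n) (Nat.cast_nonneg n)
      have : d ≤ c := min_le_left _ _
      gcongr
  · exact Eventually.of_forall fun n => prob_le_one

/-! ### Vertices without late edges -/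

section Late

variable {V : Type*} [Fintype V] [DecidableEq V] {K : ℕ}

/-- The slots in the second half of the time interval. -/
def IsLate (K : ℕ) (s : ℕ) : Prop := K ≤ s ∧ s < 2 * K

instance (K s : ℕ) : Decidable (IsLate K s) := inferInstanceAs (Decidable (_ ∧ _))

/-- The proper pairs containing `v`. -/
def star (v : V) : Finset (Sym2 V) := (Finset.univ.erase v).image fun u => s(u, v)

theorem mem_star {u v : V} (h : u ≠ v) : s(u, v) ∈ star v :=
  Finset.mem_image.2 ⟨u, by simp [h], rfl⟩

/-- `v` is incident to no edge in a late slot. -/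
def LateIsolated (Y : Sym2 V → Fin (2 * K + 1)) (v : V) : Prop :=
  ∀ e ∈ star v, ¬ IsLate K (Y e)

instance (Y : Sym2 V → Fin (2 * K + 1)) (v : V) : Decidable (LateIsolated Y v) :=
  inferInstanceAs (Decidable (∀ e ∈ star v, _))

/-- The `j`-th pair of the sequence of vertices `f 0, …, f (k - 1), v`. -/
def chainEdge {k : ℕ} (f : Fin k → V) (v : V) (j : Fin k) : Sym2 V :=
  s((Fin.snoc f v : Fin (k + 1) → V) j.castSucc, (Fin.snoc f v : Fin (k + 1) → V) j.succ)

/-- The sequence of distinct vertices `f 0, …, f (k - 1), v` passes through the slots `g`. -/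
def IsChain {k : ℕ} (Y : Sym2 V → Fin (2 * K + 1)) (v : V) (f : Fin k → V) (g : Fin k → Fin K) :
    Prop :=
  Function.Injective (Fin.snoc f v : Fin (k + 1) → V) ∧
    ∀ j, (Y (chainEdge f v j) : ℕ) = g j

/-- A time-respecting path to a vertex without late edges passes through early slots in
nondecreasing order. -/
theorem exists_isChain_of_reaches (Y : Sym2 V → Fin (2 * K + 1))
    (σ : EdgeOrder (slotGraph Y)) (hσ : Refines (fun e : (slotGraph Y).edgeSet => Y e) σ)
    {u v : V} {t : ℝ} (hv : LateIsolated Y v)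
    (h : (ofEdgeOrder (slotGraph Y) σ).Reaches u v t) :
    ∃ k < Fintype.card V, ∃ (f : Fin k → V) (g : Fin k → Fin K), Monotone g ∧ IsChain Y v f g ∧
      (Fin.snoc f v : Fin (k + 1) → V) 0 = u := by
  obtain ⟨p, ℓ, hp, hℓ, hpw, -⟩ := h
  change (slotGraph Y).Walk u v at p
  change p.IsPath at hp
  change List.Forall₂ (fun e s => ∃ he : e ∈ (slotGraph Y).edgeSet,
    s ∈ ({((σ ⟨e, he⟩ : ℕ) : ℝ) + 1} : Finset ℝ)) p.edges ℓ at hℓ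
  set k := p.length with hk
  let f : Fin k → V := fun j => p.getVert j
  have hsnoc : ∀ j : Fin (k + 1), (Fin.snoc f v : Fin (k + 1) → V) j = p.getVert j := by
    intro j
    refine Fin.lastCases ?_ (fun i => ?_) j
    · simp [hk]
    · simp [f]
  have hedge : ∀ j : Fin k, chainEdge f v j = s(p.getVert j, p.getVert (j + 1)) := by
    intro j
    simp [chainEdge, hsnoc]
  have hadj : ∀ j : Fin k, chainEdge f v j ∈ (slotGraph Y).edgeSet := by
    intro j
    rw [hedge]
    exact p.adj_getVert_succ j.2
  have hlen : p.edges.length = ℓ.length := hℓ.length_eq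
  have hel : p.edges.length = k := p.length_edges
  have hlab : ∀ (j : Fin k) (hj : (j : ℕ) < ℓ.length),
      ℓ[(j : ℕ)] = ((σ ⟨_, hadj j⟩ : ℕ) : ℝ) + 1 := by
    intro j hj
    have hje : (j : ℕ) < p.edges.length := hlen ▸ hj
    obtain ⟨he, hmem⟩ := (List.forall₂_iff_get.1 hℓ).2 j hje hj
    have h2 : p.edges.get ⟨j, hje⟩ = chainEdge f v j := by
      rw [hedge, List.get_eq_getElem]
      exact p.getElem_edges ..
    rw [Finset.mem_singleton] at hmem
    rw [List.get_eq_getElem] at hmem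
    rw [hmem]
    simp only [h2]
  have hmono : ∀ i j : Fin k, i ≤ j → Y (chainEdge f v i) ≤ Y (chainEdge f v j) := by
    intro i j hij
    rcases hij.eq_or_lt with rfl | hlt
    · exact le_rfl
    by_contra hcon
    have h1 := hσ ⟨_, hadj j⟩ ⟨_, hadj i⟩ (not_le.1 hcon)
    have h2 := List.pairwise_iff_getElem.1 hpw i j (by omega) (by omega) hlt
    rw [hlab, hlab, add_lt_add_iff_right, Nat.cast_lt] at h2
    exact lt_asymm h1 h2
  have hearly : ∀ j : Fin k, (Y (chainEdge f v j) : ℕ) < K := by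
    intro j
    have hkpos : 0 < k := j.pos
    let l : Fin k := ⟨k - 1, by omega⟩
    have hl : j ≤ l := Fin.le_def.2 (by simp only [l]; omega)
    refine lt_of_le_of_lt (Fin.le_def.1 (hmono j l hl)) ?_
    have he : chainEdge f v l = s(p.getVert (k - 1), v) := by
      rw [hedge]
      simp only [l]
      rw [Nat.sub_add_cancel hkpos, hk, p.getVert_length]
    have hne : p.getVert (k - 1) ≠ v := by
      have := hadj l
      rw [he, SimpleGraph.mem_edgeSet] at this
      exact this.ne
    have h1 := hv _ (mem_star hne)
    have h2 := (mem_edgeSet_slotGraph.1 (hadj l)).1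
    rw [he] at h2 ⊢
    unfold IsLate at h1
    omega
  have hinj : Function.Injective (Fin.snoc f v : Fin (k + 1) → V) := by
    intro i j hij
    rw [hsnoc, hsnoc] at hij
    have hi := i.is_lt
    have hj := j.is_lt
    exact Fin.ext (hp.getVert_injOn (Nat.lt_succ_iff.1 hi) (Nat.lt_succ_iff.1 hj) hij)
  refine ⟨k, ?_, f, fun j => ⟨Y (chainEdge f v j), hearly j⟩, ?_, ⟨hinj, fun j => rfl⟩, ?_⟩
  · simpa using Fintype.card_le_of_injective _ hinj
  · intro i j hij
    exact Fin.le_def.2 (Fin.le_def.1 (hmono i j hij))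
  · rw [hsnoc]
    simp

open scoped Classical in
/-- The vertices from which some chain through early slots leads to `v`. -/
noncomputable def earlyReach (Y : Sym2 V → Fin (2 * K + 1)) (v : V) : Finset V :=
  Finset.univ.filter fun u => ∃ k < Fintype.card V, ∃ (f : Fin k → V) (g : Fin k → Fin K),
    Monotone g ∧ IsChain Y v f g ∧ (Fin.snoc f v : Fin (k + 1) → V) 0 = u

theorem mem_earlyReach {Y : Sym2 V → Fin (2 * K + 1)} {u v : V} :
    u ∈ earlyReach Y v ↔ ∃ k < Fintype.card V, ∃ (f : Fin k → V) (g : Fin k → Fin K),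
      Monotone g ∧ IsChain Y v f g ∧ (Fin.snoc f v : Fin (k + 1) → V) 0 = u := by
  simp [earlyReach]

/-- Two vertices without late edges that are reached early by at most a quarter of all vertices
each make the doubling time infinite. -/
theorem double_eq_top_of_lateIsolated (Y : Sym2 V → Fin (2 * K + 1))
    (σ : EdgeOrder (slotGraph Y)) (hσ : Refines (fun e : (slotGraph Y).edgeSet => Y e) σ)
    {v₁ v₂ : V} (hne : v₁ ≠ v₂) (h₁ : LateIsolated Y v₁) (h₂ : LateIsolated Y v₂)
    (hr₁ : 4 * (earlyReach Y v₁).card ≤ Fintype.card V)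
    (hr₂ : 4 * (earlyReach Y v₂).card ≤ Fintype.card V) :
    (ofEdgeOrder (slotGraph Y) σ).double = ⊤ := by
  set H := ofEdgeOrder (slotGraph Y) σ
  have hcard : Fintype.card V / 2 ≤ ((earlyReach Y v₁ ∪ earlyReach Y v₂)ᶜ).card := by
    rw [Finset.card_compl]
    have := Finset.card_union_le (earlyReach Y v₁) (earlyReach Y v₂)
    omega
  obtain ⟨S, hS, hSc⟩ := Finset.exists_subset_card_eq hcard
  have hball : ∀ t, H.ball S t ⊆ (({v₁, v₂} : Finset V)ᶜ : Finset V) := by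
    intro t w ⟨u, hu, hr⟩
    have hu' := hS hu
    rw [Finset.mem_compl, Finset.mem_union, not_or] at hu'
    rw [Finset.coe_compl, Set.mem_compl_iff, Finset.mem_coe, Finset.mem_insert,
      Finset.mem_singleton]
    rintro (rfl | rfl)
    · refine hu'.1 (mem_earlyReach.2 ?_)
      exact exists_isChain_of_reaches Y σ hσ h₁ hr
    · refine hu'.2 (mem_earlyReach.2 ?_)
      exact exists_isChain_of_reaches Y σ hσ h₂ hr
  have hpair : ({v₁, v₂} : Finset V).card = 2 := Finset.card_pair hne
  have hle := Finset.card_le_univ ({v₁, v₂} : Finset V)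
  have htop : H.doubleOf S = ⊤ := by
    refine iInf₂_eq_top.2 fun t ht => ?_
    exfalso
    have h1 := Set.ncard_le_ncard (hball t) (Finset.finite_toSet _)
    rw [Set.ncard_coe_finset, Finset.card_compl, hpair] at h1
    omega
  rw [eq_top_iff, ← htop]
  refine le_iSup₂ (f := fun (S : Finset V) (_ : 2 * S.card ≤ Nat.card V) => H.doubleOf S) S ?_
  rw [Nat.card_eq_fintype_card]
  omega

end Late

open scoped Classical in
theorem card_monotone_le_multichoose (K k : ℕ) :
    (Finset.univ.filter fun g : Fin k → Fin K => Monotone g).card ≤ K.multichoose k := by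
  have hcard : Fintype.card (Sym (Fin K) k) = K.multichoose k := by
    simpa using Sym.card_sym_eq_multichoose (Fin K) k
  rw [← hcard, ← Finset.card_univ]
  refine Finset.card_le_card_of_injOn
    (fun g => (⟨(List.ofFn g : Multiset (Fin K)), by simp⟩ : Sym (Fin K) k))
    (fun _ _ => Finset.mem_coe.2 (Finset.mem_univ _)) ?_
  intro g hg g' hg' h
  simp only [Finset.coe_filter, Finset.mem_univ, true_and, Set.mem_ofPred_eq] at hg hg'
  have hperm : (List.ofFn g).Perm (List.ofFn g') := Multiset.coe_eq_coe.1 (congrArg Subtype.val h)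
  exact List.ofFn_injective (hperm.eq_of_pairwise' hg.sortedLE_ofFn.pairwise
    hg'.sortedLE_ofFn.pairwise)

theorem sum_multichoose_mul_pow_le {x : ℝ} (hx0 : 0 ≤ x) (hx1 : x < 1) (K n : ℕ) :
    ∑ k ∈ Finset.range n, (K.multichoose k : ℝ) * x ^ k ≤ ((1 - x)⁻¹) ^ K := by
  have hpos : 0 < 1 - x := by linarith
  induction K with
  | zero =>
    rw [pow_zero]
    cases n with
    | zero => simp
    | succ n => simp [Finset.sum_range_succ']
  | succ K ih =>
    rw [pow_succ, ← div_eq_mul_inv, le_div_iff₀ hpos]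
    refine le_trans ?_ ih
    cases n with
    | zero => simp
    | succ n =>
      have hle : ∑ k ∈ Finset.range n, ((K + 1).multichoose k : ℝ) * x ^ k ≤
          ∑ k ∈ Finset.range (n + 1), ((K + 1).multichoose k : ℝ) * x ^ k :=
        Finset.sum_le_sum_of_subset_of_nonneg (Finset.range_mono (Nat.le_succ n))
          fun k _ _ => by positivity
      have hrec : ∑ k ∈ Finset.range (n + 1), ((K + 1).multichoose k : ℝ) * x ^ k =
          ∑ k ∈ Finset.range (n + 1), (K.multichoose k : ℝ) * x ^ k +
            x * ∑ k ∈ Finset.range n, ((K + 1).multichoose k : ℝ) * x ^ k := by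
        rw [Finset.sum_range_succ', Finset.sum_range_succ', Finset.mul_sum, add_right_comm,
          ← Finset.sum_add_distrib]
        simp only [Nat.multichoose_zero_right, Nat.multichoose_succ_succ]
        congr 1
        refine Finset.sum_congr rfl fun k _ => ?_
        push_cast
        ring
      nlinarith [mul_le_mul_of_nonneg_left hle hx0]

theorem expect_ite_forall {E κ : Type*} [Fintype E] [DecidableEq E] [Fintype κ]
    {w : E → κ → ℝ} (hw1 : ∀ e, ∑ s, w e s = 1) (F : Finset E) (P : E → κ → Prop)
    [∀ e, DecidablePred (P e)] [DecidablePred fun Y : E → κ => ∀ e ∈ F, P e (Y e)] :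
    expect w (fun Y => if ∀ e ∈ F, P e (Y e) then 1 else 0) =
      ∏ e ∈ F, ∑ s, if P e s then w e s else 0 := by
  have h : ∀ Y : E → κ, (if ∀ e ∈ F, P e (Y e) then (1 : ℝ) else 0) =
      ∏ e, if e ∈ F then (if P e (Y e) then 1 else 0) else 1 := by
    intro Y
    rw [Finset.prod_ite_mem, Finset.univ_inter]
    split_ifs with hY
    · exact (Finset.prod_eq_one fun e he => if_pos (hY e he)).symm
    · push Not at hY
      obtain ⟨e, he, hne⟩ := hY
      exact (Finset.prod_eq_zero he (if_neg hne)).symm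
  simp only [h]
  rw [expect_prod w (fun e s => if e ∈ F then (if P e s then 1 else 0) else 1),
    ← Finset.prod_subset (Finset.subset_univ F)]
  · refine Finset.prod_congr rfl fun e he => ?_
    simp [he]
  · intro e _ he
    simp [he, hw1]

theorem sum_slotWeight_not_late {V : Type*} {K : ℕ} {p : ℝ} (hK : 0 < K) {e : Sym2 V}
    (he : ¬ e.IsDiag) :
    ∑ s : Fin (2 * K + 1), (if ¬ IsLate K s then slotWeight (2 * K) p e s else 0) = 1 - p / 2 := by
  have hK' : (K : ℝ) ≠ 0 := by positivity
  have h := Fin.sum_univ_eq_sum_range (fun s : ℕ => if ¬ IsLate K s then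
    (if s < 2 * K then p / (2 * K : ℕ) else 1 - p) else 0) (2 * K + 1)
  simp only [slotWeight, he, if_false]
  rw [h, Finset.sum_range_succ, two_mul, Finset.sum_range_add]
  have h1 : ∀ s ∈ Finset.range K, (if ¬ IsLate K s then
      (if s < K + K then p / (K + K : ℕ) else 1 - p) else 0) = p / (K + K : ℕ) := by
    intro s hs
    rw [Finset.mem_range] at hs
    rw [if_pos (by unfold IsLate; omega), if_pos (by omega)]
  have h2 : ∀ s ∈ Finset.range K, (if ¬ IsLate K (K + s) then
      (if K + s < K + K then p / (K + K : ℕ) else 1 - p) else 0) = 0 := by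
    intro s hs
    rw [Finset.mem_range] at hs
    rw [if_neg (by unfold IsLate; omega)]
  rw [Finset.sum_congr rfl h1, Finset.sum_congr rfl h2]
  have h3 : ¬ IsLate K (K + K) := by unfold IsLate; omega
  simp [h3]
  field_simp
  ring

section LateProb

variable {V : Type*} [Fintype V] [DecidableEq V] {K : ℕ} {p : ℝ}

theorem not_isDiag_of_mem_star {v : V} {e : Sym2 V} (he : e ∈ star v) : ¬ e.IsDiag := by
  obtain ⟨u, hu, rfl⟩ := Finset.mem_image.1 he
  simpa using hu

theorem card_star (v : V) : (star v).card = Fintype.card V - 1 := by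
  rw [star, Finset.card_image_of_injective, Finset.card_erase_of_mem (Finset.mem_univ v),
    Finset.card_univ]
  exact fun a b h => Sym2.congr_left.1 h

theorem star_inter_star {u v : V} (h : u ≠ v) : star u ∩ star v = {s(u, v)} := by
  ext e
  simp only [star, Finset.mem_inter, Finset.mem_image, Finset.mem_erase, Finset.mem_univ, and_true,
    Finset.mem_singleton]
  constructor
  · rintro ⟨⟨a, ha, rfl⟩, ⟨b, hb, hab⟩⟩
    rw [Sym2.eq_iff] at hab
    obtain ⟨rfl, rfl⟩ | ⟨rfl, rfl⟩ := hab
    · exact absurd rfl h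
    · exact Sym2.eq_swap
  · rintro rfl
    exact ⟨⟨v, h.symm, Sym2.eq_swap⟩, ⟨u, h, rfl⟩⟩

theorem expect_not_late (hK : 0 < K) (F : Finset (Sym2 V)) (hF : ∀ e ∈ F, ¬ e.IsDiag) :
    expect (slotWeight (2 * K) p) (fun Y => if ∀ e ∈ F, ¬ IsLate K (Y e) then 1 else 0) =
      (1 - p / 2) ^ F.card := by
  rw [expect_ite_forall (sum_slotWeight (by omega) p) F (fun _ s => ¬ IsLate K s),
    Finset.prod_congr rfl fun e he => sum_slotWeight_not_late hK (hF e he), Finset.prod_const]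

theorem expect_lateIsolated (hK : 0 < K) (v : V) :
    expect (slotWeight (2 * K) p) (fun Y => if LateIsolated Y v then 1 else 0) =
      (1 - p / 2) ^ (Fintype.card V - 1) := by
  rw [← card_star v]
  exact expect_not_late hK (star v) fun e he => not_isDiag_of_mem_star he

theorem expect_lateIsolated_and (hK : 0 < K) {u v : V} (huv : u ≠ v) :
    expect (slotWeight (2 * K) p)
      (fun Y => if LateIsolated Y u ∧ LateIsolated Y v then 1 else 0) =
      (1 - p / 2) ^ (2 * Fintype.card V - 3) := by
  have hcard : (star u ∪ star v).card = 2 * Fintype.card V - 3 := by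
    have h := Finset.card_union_add_card_inter (star u) (star v)
    rw [star_inter_star huv, Finset.card_singleton, card_star, card_star] at h
    omega
  rw [← hcard, ← expect_not_late hK (star u ∪ star v)]
  · congr 1
    ext Y
    refine if_congr ?_ rfl rfl
    simp only [LateIsolated, Finset.mem_union]
    exact ⟨fun h e he => he.elim (h.1 e) (h.2 e),
      fun h => ⟨fun e he => h e (.inl he), fun e he => h e (.inr he)⟩⟩
  · intro e he
    exact (Finset.mem_union.1 he).elim not_isDiag_of_mem_star not_isDiag_of_mem_star

open scoped Classical in
theorem expect_isChain_le (hK : 0 < K) (h0 : 0 ≤ p) (h1 : p ≤ 1) (v : V) {k : ℕ} (f : Fin k → V)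
    (g : Fin k → Fin K) :
    expect (slotWeight (2 * K) p)
      (fun Y => if LateIsolated Y v ∧ IsChain Y v f g then 1 else 0) ≤
      (p / (2 * K : ℕ)) ^ k * (1 - p / 2) ^ (Fintype.card V - 2) := by
  have hp2 : 0 ≤ 1 - p / 2 := by linarith
  by_cases hinj : Function.Injective (Fin.snoc f v : Fin (k + 1) → V)
  swap
  · have : ∀ Y : Sym2 V → Fin (2 * K + 1), ¬ (LateIsolated Y v ∧ IsChain Y v f g) :=
      fun Y h => hinj h.2.1
    simp only [this, if_false]
    simp only [expect, mul_zero, Finset.sum_const_zero]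
    positivity
  set c : Fin (k + 1) → V := Fin.snoc f v with hc
  have hlast : c (Fin.last k) = v := by simp [hc]
  let z : V := c ⟨k - 1, by omega⟩
  let F₁ : Finset (Sym2 V) := Finset.univ.image (chainEdge f v)
  let F₂ : Finset (Sym2 V) := ((Finset.univ.erase v).erase z).image fun u => s(u, v)
  have hchain : ∀ j, chainEdge f v j = s(c j.castSucc, c j.succ) := fun j => rfl
  have hF₂star : F₂ ⊆ star v := Finset.image_subset_image (Finset.erase_subset _ _)
  have hcinj : Function.Injective (chainEdge f v) := by
    intro i j hij
    rw [hchain, hchain, Sym2.eq_iff] at hij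
    obtain ⟨h, -⟩ | ⟨h, h'⟩ := hij
    · exact Fin.castSucc_injective _ (hinj h)
    · have e1 := congrArg Fin.val (hinj h)
      have e2 := congrArg Fin.val (hinj h')
      simp only [Fin.val_castSucc, Fin.val_succ] at e1 e2
      omega
  have hcdiag : ∀ j, ¬ (chainEdge f v j).IsDiag := by
    intro j
    rw [hchain, Sym2.mk_isDiag_iff]
    intro h
    have e1 := congrArg Fin.val (hinj h)
    simp at e1
  have hnot : ∀ j, chainEdge f v j ∉ F₂ := by
    intro j hj
    obtain ⟨u, hu, he⟩ := Finset.mem_image.1 hj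
    simp only [Finset.mem_erase, Finset.mem_univ, and_true] at hu
    rw [hchain, Sym2.eq_iff] at he
    rw [← hlast] at he
    obtain ⟨h, h'⟩ | ⟨h, h'⟩ := he
    · have e1 := congrArg Fin.val (hinj h')
      simp only [Fin.val_last, Fin.val_succ] at e1
      refine hu.1 ?_
      rw [h]
      simp only [z]
      congr 1
      ext
      simp only [Fin.val_castSucc]
      omega
    · have e1 := congrArg Fin.val (hinj h')
      simp only [Fin.val_last, Fin.val_castSucc] at e1
      omega
  have hdisj : Disjoint F₁ F₂ := by
    rw [Finset.disjoint_left]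
    intro e he
    obtain ⟨j, -, rfl⟩ := Finset.mem_image.1 he
    exact hnot j
  have hF₂card : Fintype.card V - 2 ≤ F₂.card := by
    rw [Finset.card_image_of_injective]
    · have := Finset.pred_card_le_card_erase (s := Finset.univ.erase v) (a := z)
      rw [Finset.card_erase_of_mem (Finset.mem_univ v), Finset.card_univ] at this
      omega
    · exact fun a b h => Sym2.congr_left.1 h
  let P : Sym2 V → Fin (2 * K + 1) → Prop := fun e s =>
    if e ∈ F₂ then ¬ IsLate K s else ∃ j, chainEdge f v j = e ∧ (s : ℕ) = g j
  calc _ ≤ expect (slotWeight (2 * K) p)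
        (fun Y => if ∀ e ∈ F₁ ∪ F₂, P e (Y e) then 1 else 0) := by
        refine expect_mono (slotWeight_nonneg h0 h1) fun Y => ?_
        by_cases hY : LateIsolated Y v ∧ IsChain Y v f g
        · rw [if_pos hY, if_pos]
          intro e he
          by_cases he2 : e ∈ F₂
          · simp only [P, he2, if_true]
            exact hY.1 e (hF₂star he2)
          · simp only [P, he2, if_false]
            obtain ⟨j, -, rfl⟩ := Finset.mem_image.1 ((Finset.mem_union.1 he).resolve_right he2)
            exact ⟨j, rfl, hY.2.2 j⟩
        · rw [if_neg hY]
          split_ifs <;> norm_num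
    _ = (∏ e ∈ F₁, ∑ s, if P e s then slotWeight (2 * K) p e s else 0) *
        ∏ e ∈ F₂, ∑ s, if P e s then slotWeight (2 * K) p e s else 0 := by
        rw [expect_ite_forall (sum_slotWeight (by omega) p), Finset.prod_union hdisj]
    _ = (p / (2 * K : ℕ)) ^ k * (1 - p / 2) ^ F₂.card := by
        congr 1
        · rw [Finset.prod_image fun i _ j _ h => hcinj h]
          rw [Finset.prod_congr rfl (g := fun _ => p / (2 * K : ℕ)), Finset.prod_const,
            Finset.card_univ, Fintype.card_fin]
          intro j _
          have hg := (g j).is_lt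
          rw [Finset.sum_eq_single (⟨g j, by omega⟩ : Fin (2 * K + 1))]
          · rw [if_pos]
            · have : (g j : ℕ) < 2 * K := by omega
              simp [slotWeight, hcdiag j, this]
            · simp only [P, hnot j, if_false]
              exact ⟨j, rfl, rfl⟩
          · intro s _ hs
            rw [if_neg]
            simp only [P, hnot j, if_false]
            rintro ⟨j', hj', hs'⟩
            rw [hcinj hj'] at hs'
            exact hs (Fin.ext hs')
          · simp
        · rw [← Finset.prod_const]
          refine Finset.prod_congr rfl fun e he => ?_
          have : ∀ s, P e s ↔ ¬ IsLate K s := fun s => by simp only [P, he, if_true]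
          simp only [this]
          convert sum_slotWeight_not_late (p := p) hK (not_isDiag_of_mem_star (hF₂star he))
    _ ≤ _ := by
        exact mul_le_mul_of_nonneg_left (pow_le_pow_of_le_one hp2 (by linarith) hF₂card)
          (by positivity)

theorem expect_lateIsolated_mul_card_earlyReach_le (hK : 0 < K) (h0 : 0 ≤ p) (h1 : p ≤ 1)
    (hx : Fintype.card V * (p / (2 * K : ℕ)) < 1) (v : V) :
    expect (slotWeight (2 * K) p)
      (fun Y => if LateIsolated Y v then ((earlyReach Y v).card : ℝ) else 0) ≤
      (1 - p / 2) ^ (Fintype.card V - 2) * ((1 - Fintype.card V * (p / (2 * K : ℕ)))⁻¹) ^ K := by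
  classical
  have hp2 : 0 ≤ 1 - p / 2 := by linarith
  set n := Fintype.card V with hn
  let mono : (k : ℕ) → Finset (Fin k → Fin K) := fun k => Finset.univ.filter fun g => Monotone g
  have hpoint : ∀ Y : Sym2 V → Fin (2 * K + 1),
      (if LateIsolated Y v then ((earlyReach Y v).card : ℝ) else 0) ≤
      ∑ k ∈ Finset.range n, ∑ f : Fin k → V, ∑ g ∈ mono k,
        if LateIsolated Y v ∧ IsChain Y v f g then 1 else 0 := by
    intro Y
    by_cases hY : LateIsolated Y v
    swap
    · rw [if_neg hY]
      refine Finset.sum_nonneg fun k _ => Finset.sum_nonneg fun f _ =>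
        Finset.sum_nonneg fun g _ => ?_
      split_ifs <;> norm_num
    simp only [hY, true_and, if_true]
    let I : Finset (Σ k : ℕ, (Fin k → V) × (Fin k → Fin K)) :=
      (Finset.range n).sigma fun k => Finset.univ ×ˢ mono k
    have hcard : (earlyReach Y v).card ≤ (I.filter fun i => IsChain Y v i.2.1 i.2.2).card := by
      have hsub : earlyReach Y v ⊆ (I.filter fun i => IsChain Y v i.2.1 i.2.2).image
          fun i => (Fin.snoc i.2.1 v : Fin (i.1 + 1) → V) 0 := by
        intro u hu
        obtain ⟨k, hk, f, g, hg, hch, hu⟩ := mem_earlyReach.1 hu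
        refine Finset.mem_image.2 ⟨⟨k, f, g⟩, Finset.mem_filter.2 ⟨?_, hch⟩, hu⟩
        simp only [I, mono, Finset.mem_sigma, Finset.mem_range, Finset.mem_product,
          Finset.mem_univ, Finset.mem_filter, true_and]
        exact ⟨hk, hg⟩
      exact (Finset.card_le_card hsub).trans Finset.card_image_le
    calc ((earlyReach Y v).card : ℝ) ≤ ((I.filter fun i => IsChain Y v i.2.1 i.2.2).card : ℝ) := by
          exact_mod_cast hcard
      _ = ∑ i ∈ I, if IsChain Y v i.2.1 i.2.2 then 1 else 0 := by
          rw [Finset.sum_boole]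
      _ = _ := by
          rw [Finset.sum_sigma]
          refine Finset.sum_congr rfl fun k _ => ?_
          rw [Finset.sum_product]
  refine (expect_mono (slotWeight_nonneg h0 h1) hpoint).trans ?_
  simp only [expect_sum]
  have hx0 : 0 ≤ (n : ℝ) * (p / (2 * K : ℕ)) := by positivity
  calc _ ≤ ∑ k ∈ Finset.range n, ∑ _f : Fin k → V, ∑ _g ∈ mono k,
        (p / (2 * K : ℕ)) ^ k * (1 - p / 2) ^ (n - 2) := by
        refine Finset.sum_le_sum fun k _ => Finset.sum_le_sum fun f _ =>
          Finset.sum_le_sum fun g _ => ?_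
        convert expect_isChain_le hK h0 h1 v f g
    _ = ∑ k ∈ Finset.range n, (1 - p / 2) ^ (n - 2) *
        (((mono k).card : ℝ) * (n * (p / (2 * K : ℕ))) ^ k) := by
        refine Finset.sum_congr rfl fun k _ => ?_
        simp only [Finset.sum_const, nsmul_eq_mul, Finset.card_univ, Fintype.card_fun,
          Fintype.card_fin, ← hn, Nat.cast_pow]
        ring
    _ ≤ ∑ k ∈ Finset.range n, (1 - p / 2) ^ (n - 2) *
        ((K.multichoose k : ℝ) * (n * (p / (2 * K : ℕ))) ^ k) := by
        refine Finset.sum_le_sum fun k _ => ?_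
        gcongr
        convert card_monotone_le_multichoose K k
    _ ≤ _ := by
        rw [← Finset.mul_sum]
        gcongr
        exact sum_multichoose_mul_pow_le hx0 hx K n

end LateProb

/-- If at most one marked point has small weight, then the number of marked points is far from
`μ` or the total weight of the marked points is large. -/
theorem one_le_sq_add_weight {ι : Type*} [Fintype ι] {n μ : ℝ} (hn : 0 < n) (hμ : 8 ≤ μ)
    (P : ι → Prop) [DecidablePred P] (r : ι → ℝ) (hr : ∀ v, 0 ≤ r v)
    [DecidablePred fun v => P v ∧ 4 * r v ≤ n]
    (hcard : (Finset.univ.filter fun v => P v ∧ 4 * r v ≤ n).card ≤ 1) :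
    1 ≤ 4 / μ ^ 2 * ((∑ v, if P v then 1 else 0) - μ) ^ 2 +
      4 / μ * (4 / n * ∑ v, if P v then r v else 0) := by
  have hμ0 : 0 < μ := by linarith
  set Z : ℝ := ∑ v, if P v then 1 else 0 with hZ
  set b : ℝ := 4 / n * ∑ v, if P v then r v else 0 with hb
  have hb0 : 0 ≤ b := mul_nonneg (by positivity) (Finset.sum_nonneg fun v _ => by
    split_ifs
    · exact hr v
    · exact le_rfl)
  have hZb : Z ≤ 1 + b := by
    have h1 : Z ≤ (Finset.univ.filter fun v => P v ∧ 4 * r v ≤ n).card + b := by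
      rw [hZ, hb, Finset.mul_sum, Finset.card_filter, Nat.cast_sum, ← Finset.sum_add_distrib]
      refine Finset.sum_le_sum fun v _ => ?_
      by_cases hv : P v
      · by_cases hs : 4 * r v ≤ n
        · have := mul_nonneg (by positivity : 0 ≤ 4 / n) (hr v)
          simpa [hv, hs] using this
        · have h4 : 1 ≤ 4 / n * r v := by
            rw [div_mul_eq_mul_div, le_div_iff₀ hn]
            linarith
          simpa [hv, hs] using h4
      · simp [hv]
    have h2 : ((Finset.univ.filter fun v => P v ∧ 4 * r v ≤ n).card : ℝ) ≤ 1 := by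
      exact_mod_cast hcard
    linarith
  have hsq0 : 0 ≤ 4 / μ ^ 2 * (Z - μ) ^ 2 := by positivity
  have hbb : 0 ≤ 4 / μ * b := by positivity
  rcases le_or_gt (μ / 4) b with h | h
  · have : 1 ≤ 4 / μ * b := by
      rw [div_mul_eq_mul_div, le_div_iff₀ hμ0]
      linarith
    linarith
  · have h1 : μ / 2 ≤ μ - Z := by linarith
    have h2 : (μ / 2) ^ 2 ≤ (μ - Z) ^ 2 := pow_le_pow_left₀ (by linarith) h1 2
    have : 1 ≤ 4 / μ ^ 2 * (Z - μ) ^ 2 := by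
      rw [div_mul_eq_mul_div, le_div_iff₀ (by positivity)]
      linarith
    linarith

/-- A quantitative lower bound for the probability of an infinite doubling time, from the first
two moments of the number of vertices without late edges. -/
theorem rstg_double_eq_top_ge {n K : ℕ} (hn : 2 ≤ n) (hK : 0 < K) (p : unitInterval) {μ Q B : ℝ}
    (hQ : Q = 1 - (p : ℝ) / 2) (hμ : μ = n * Q ^ (n - 1)) (hμ8 : 8 ≤ μ)
    (hx : n * ((p : ℝ) / (2 * K : ℕ)) < 1) (hB : B = ((1 - n * ((p : ℝ) / (2 * K : ℕ)))⁻¹) ^ K) :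
    ENNReal.ofReal (1 - (4 * (1 / Q - 1) + 4 / μ + 16 * B / (n * Q))) ≤
      (rstg (Fin n) p).toMeasure {H | H.double = ⊤} := by
  classical
  have hp0 : 0 ≤ (p : ℝ) := p.2.1
  have hp1 : (p : ℝ) ≤ 1 := p.2.2
  have hQ0 : 0 < Q := by rw [hQ]; linarith
  have hn0 : (0 : ℝ) < n := by exact_mod_cast (by omega : 0 < n)
  have hμ0 : 0 < μ := by linarith
  set w : Sym2 (Fin n) → Fin (2 * K + 1) → ℝ := slotWeight (2 * K) p with hwdef
  have hw : ∀ e s, 0 ≤ w e s := slotWeight_nonneg hp0 hp1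
  have hw1 : ∀ e, ∑ s, w e s = 1 := sum_slotWeight (by omega) p
  let iso : Fin n → (Sym2 (Fin n) → Fin (2 * K + 1)) → ℝ :=
    fun v Y => if LateIsolated Y v then 1 else 0
  let iso₂ : Fin n → Fin n → (Sym2 (Fin n) → Fin (2 * K + 1)) → ℝ :=
    fun u v Y => if LateIsolated Y u ∧ LateIsolated Y v then 1 else 0
  let R : Fin n → (Sym2 (Fin n) → Fin (2 * K + 1)) → ℝ :=
    fun v Y => if LateIsolated Y v then ((earlyReach Y v).card : ℝ) else 0
  let good : (Sym2 (Fin n) → Fin (2 * K + 1)) → Finset (Fin n) := fun Y =>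
    Finset.univ.filter fun v => LateIsolated Y v ∧ 4 * (earlyReach Y v).card ≤ n
  let S : Set (Sym2 (Fin n) → Fin (2 * K + 1)) := {Y | 2 ≤ (good Y).card}
  have hpoint : ∀ Y, (1 : ℝ) ≤ (if Y ∈ S then 1 else 0) +
      (4 / μ ^ 2 * ((∑ u, ∑ v, iso₂ u v Y) + (-(2 * μ) * (∑ v, iso v Y) + μ ^ 2 * 1)) +
        4 / μ * (4 / n * ∑ v, R v Y)) := by
    intro Y
    have hR0 : ∀ v, 0 ≤ R v Y := fun v => by simp only [R]; split_ifs <;> positivity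
    have hsq : (∑ u, ∑ v, iso₂ u v Y) = (∑ v, iso v Y) ^ 2 := by
      rw [sq, Finset.sum_mul_sum]
      refine Finset.sum_congr rfl fun u _ => Finset.sum_congr rfl fun v _ => ?_
      by_cases h₁ : LateIsolated Y u <;> by_cases h₂ : LateIsolated Y v <;>
        simp only [iso₂, iso, h₁, h₂, and_true, and_false, if_true, if_false, mul_one, mul_zero]
    have hform : (∑ u, ∑ v, iso₂ u v Y) + (-(2 * μ) * (∑ v, iso v Y) + μ ^ 2 * 1) =
        ((∑ v, iso v Y) - μ) ^ 2 := by
      rw [hsq]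
      ring
    rw [hform]
    by_cases hY : Y ∈ S
    · rw [if_pos hY]
      have h1 : 0 ≤ 4 / μ * (4 / n * ∑ v, R v Y) := mul_nonneg (by positivity)
        (mul_nonneg (by positivity) (Finset.sum_nonneg fun v _ => hR0 v))
      have h2 : 0 ≤ 4 / μ ^ 2 * ((∑ v, iso v Y) - μ) ^ 2 := by positivity
      linarith
    · rw [if_neg hY, zero_add]
      refine one_le_sq_add_weight hn0 hμ8 (LateIsolated Y) (fun v => ((earlyReach Y v).card : ℝ))
        (fun v => Nat.cast_nonneg _) ?_
      have h3 := Nat.lt_succ_iff.1 (not_le.1 hY)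
      convert h3 using 4
      norm_cast
  have hiso : ∀ v, expect w (iso v) = Q ^ (n - 1) := by
    intro v
    have := expect_lateIsolated (p := (p : ℝ)) hK v
    rw [Fintype.card_fin, ← hQ] at this
    exact this
  have hpow : Q ^ (2 * n - 3) * Q = Q ^ (n - 1) * Q ^ (n - 1) := by
    rw [← pow_succ, ← pow_add]
    congr 1
    omega
  have hiso₂ : ∑ u, ∑ v, expect w (iso₂ u v) ≤ μ ^ 2 / Q + μ := by
    have hle : ∀ u v, expect w (iso₂ u v) ≤
        Q ^ (2 * n - 3) + if u = v then Q ^ (n - 1) else 0 := by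
      intro u v
      by_cases huv : u = v
      · subst huv
        have h1 : expect w (iso₂ u u) = expect w (iso u) := by
          congr 1
          ext Y
          simp [iso₂, iso]
        rw [h1, hiso, if_pos rfl]
        exact le_add_of_nonneg_left (by positivity)
      · have := expect_lateIsolated_and (p := (p : ℝ)) hK huv
        rw [Fintype.card_fin, ← hQ] at this
        rw [if_neg huv, add_zero]
        exact this.le
    calc ∑ u, ∑ v, expect w (iso₂ u v)
        ≤ ∑ u : Fin n, ∑ v : Fin n, (Q ^ (2 * n - 3) + if u = v then Q ^ (n - 1) else 0) :=
          Finset.sum_le_sum fun u _ => Finset.sum_le_sum fun v _ => hle u v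
      _ = n ^ 2 * Q ^ (2 * n - 3) + μ := by
          simp only [Finset.sum_add_distrib, Finset.sum_const, Finset.card_univ, Fintype.card_fin,
            nsmul_eq_mul, Finset.sum_ite_eq, Finset.mem_univ, if_true]
          rw [hμ]
          ring
      _ = μ ^ 2 / Q + μ := by
          congr 1
          rw [eq_div_iff hQ0.ne', mul_assoc, hpow, hμ]
          ring
  have hRv : ∀ v, expect w (R v) ≤ Q ^ (n - 2) * B := by
    intro v
    have := expect_lateIsolated_mul_card_earlyReach_le (p := (p : ℝ)) hK hp0 hp1
      (by rwa [Fintype.card_fin]) v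
    rw [Fintype.card_fin, ← hQ, ← hB] at this
    exact this
  have hRsum : ∑ v, expect w (R v) ≤ n * (Q ^ (n - 2) * B) := by
    refine (Finset.sum_le_card_nsmul _ _ _ fun v _ => hRv v).trans ?_
    rw [Finset.card_univ, Fintype.card_fin, nsmul_eq_mul]
  have hE := expect_mono hw hpoint
  have hone : expect w (fun _ => 1) = 1 := by
    rw [expect_one, Finset.prod_eq_one fun e _ => hw1 e]
  simp only [expect_add, expect_const_mul, expect_sum, hone, hiso] at hE
  have hμsum : ∑ _v : Fin n, Q ^ (n - 1) = μ := by
    rw [hμ]; simp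
  rw [hμsum] at hE
  have hfirst : 4 / μ ^ 2 * (∑ u, ∑ v, expect w (iso₂ u v) + (-(2 * μ) * μ + μ ^ 2 * 1)) ≤
      4 * (1 / Q - 1) + 4 / μ := by
    calc _ ≤ 4 / μ ^ 2 * (μ ^ 2 / Q + μ + (-(2 * μ) * μ + μ ^ 2 * 1)) := by gcongr
      _ = _ := by field_simp; ring
  have hsecond : 4 / μ * (4 / n * ∑ v, expect w (R v)) ≤ 16 * B / (n * Q) := by
    calc _ ≤ 4 / μ * (4 / n * (n * (Q ^ (n - 2) * B))) := by gcongr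
      _ = _ := by
        have : Q ^ (n - 1) = Q ^ (n - 2) * Q := by
          rw [← pow_succ]; congr 1; omega
        rw [hμ, this]
        have := (pow_pos hQ0 (n - 2)).ne'
        field_simp
        ring
  refine le_trans (ENNReal.ofReal_le_ofReal (?_ : _ ≤ expect w fun Y => if Y ∈ S then 1 else 0)) ?_
  · linarith
  refine expect_slotWeight_le_rstg (by omega) p S _ fun Y hY σ hσ => ?_
  obtain ⟨v₁, h₁, v₂, h₂, hne⟩ := Finset.one_lt_card.1 (show 1 < (good Y).card from hY)
  simp only [good, Finset.mem_filter, Finset.mem_univ, true_and] at h₁ h₂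
  exact double_eq_top_of_lateIsolated Y σ hσ hne h₁.1 h₂.1 (by simpa using h₁.2)
    (by simpa using h₂.2)

theorem inv_one_sub_le_exp {x : ℝ} (hx0 : 0 ≤ x) (hx : x ≤ 1 / 2) :
    (1 - x)⁻¹ ≤ Real.exp (x + 2 * x ^ 2) := by
  refine le_trans ?_ (Real.add_one_le_exp _)
  rw [inv_le_iff_one_le_mul₀ (by linarith)]
  nlinarith [mul_nonneg hx0 hx0, mul_nonneg (mul_nonneg hx0 hx0) (sub_nonneg.2 hx)]

theorem tendsto_rstg_double_eq_top (β : ℕ → unitInterval) {c : ℝ} (hc : 0 < c)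
    (hβ : ∀ᶠ n : ℕ in atTop, (β n : ℝ) < (2 - c) * (Real.log n / n)) :
    Tendsto (fun n : ℕ => (rstg (Fin n) (β n)).toMeasure {H | H.double = ⊤}) atTop (𝓝 1) := by
  have hlog : Tendsto (fun n : ℕ => Real.log n) atTop atTop :=
    Real.tendsto_log_atTop.comp tendsto_natCast_atTop_atTop
  have hquot : ∀ k : ℕ, Tendsto (fun n : ℕ => Real.log n ^ k / n) atTop (𝓝 0) := fun k => by
    have := (Real.isLittleO_pow_log_id_atTop (n := k)).tendsto_div_nhds_zero
    exact this.comp tendsto_natCast_atTop_atTop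
  have ht : Tendsto (fun n : ℕ => Real.exp (-(c / 2 * Real.log n))) atTop (𝓝 0) :=
    Real.tendsto_exp_atBot.comp (tendsto_neg_atTop_atBot.comp
      (hlog.const_mul_atTop (by positivity)))
  have hlow : Tendsto (fun n : ℕ => ENNReal.ofReal (1 - (8 * (Real.log n ^ 1 / n) +
      36 * (Real.exp 2 * Real.exp (-(c / 2 * Real.log n)))))) atTop (𝓝 1) := by
    have h1 := ENNReal.tendsto_ofReal ((((hquot 1).const_mul 8).add
      ((ht.const_mul (Real.exp 2)).const_mul 36)).const_sub 1)
    simpa using h1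
  refine tendsto_of_tendsto_of_tendsto_of_le_of_le' hlow tendsto_const_nhds ?_
    (Eventually.of_forall fun n => prob_le_one)
  filter_upwards [hβ, eventually_ge_atTop 2,
    (hquot 1).eventually_le_const (show (0 : ℝ) < 1 / 2 by norm_num),
    (hquot 2).eventually_le_const (show (0 : ℝ) < 1 by norm_num),
    (ht.const_mul (Real.exp 2)).eventually_le_const (show Real.exp 2 * 0 < 1 / 8 by norm_num)]
    with n hp hn hq1 hq2 ht8
  set L := Real.log n with hL
  set p : ℝ := (β n : ℝ) with hpdef
  have hp0 : 0 ≤ p := (β n).2.1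
  have hn0 : (0 : ℝ) < n := by exact_mod_cast (by omega : 0 < n)
  have hn2 : (2 : ℝ) ≤ n := by exact_mod_cast hn
  have hL0 : 0 ≤ L := Real.log_natCast_nonneg n
  rw [pow_one] at hq1
  set h := p / 2 with hh
  have hh0 : 0 ≤ h := by positivity
  have hnh : n * h ≤ (1 - c / 2) * L := by
    have h1 : p * n ≤ (2 - c) * L := by
      have := mul_le_mul_of_nonneg_right hp.le hn0.le
      calc p * n ≤ (2 - c) * (L / n) * n := this
        _ = _ := by field_simp
    rw [hh]
    linarith
  have hhL : h ≤ L / n := by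
    rw [le_div_iff₀ hn0]
    nlinarith
  have hh2 : h ≤ 1 / 2 := hhL.trans hq1
  have hnhh : n * h ^ 2 ≤ 1 := by
    calc n * h ^ 2 ≤ n * (L / n) ^ 2 := by gcongr
      _ = L ^ 2 / n := by field_simp
      _ ≤ 1 := hq2
  set Q := 1 - p / 2 with hQ
  have hQhalf : 1 / 2 ≤ Q := by rw [hQ]; linarith
  have hQ0 : 0 < Q := by linarith
  set E := Real.exp 2 * Real.exp (-(c / 2 * L)) with hE
  have hE0 : 0 < E := by positivity
  have hexpL : (n : ℝ) = Real.exp L := (Real.exp_log hn0).symm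
  set μ := (n : ℝ) * Q ^ (n - 1) with hμ
  have hμE : 1 / E ≤ μ := by
    have h1 : (Q⁻¹) ^ n ≤ Real.exp ((1 - c / 2) * L + 2) := by
      calc (Q⁻¹) ^ n ≤ Real.exp (h + 2 * h ^ 2) ^ n :=
            pow_le_pow_left₀ (by positivity) (inv_one_sub_le_exp hh0 hh2) n
        _ = Real.exp (n * h + 2 * (n * h ^ 2)) := by rw [← Real.exp_nat_mul]; congr 1; ring
        _ ≤ _ := Real.exp_le_exp.2 (by linarith)
    have h2 : Q ^ n ≤ Q ^ (n - 1) := pow_le_pow_of_le_one hQ0.le (by linarith) (by omega)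
    have h3 : (Real.exp ((1 - c / 2) * L + 2))⁻¹ ≤ Q ^ n := by
      rw [inv_pow] at h1
      exact inv_le_of_inv_le₀ (by positivity) h1
    calc 1 / E = n * (Real.exp ((1 - c / 2) * L + 2))⁻¹ := by
          rw [hE, hexpL, ← Real.exp_add, one_div, ← Real.exp_neg, ← Real.exp_neg, ← Real.exp_add]
          congr 1
          ring
      _ ≤ n * Q ^ (n - 1) := by gcongr; exact h3.trans h2
  have hμ8 : 8 ≤ μ := by
    refine le_trans ?_ hμE
    rw [le_div_iff₀ hE0]
    linarith
  have hxeq : (n : ℝ) * (p / (2 * n ^ 2 : ℕ)) = h / n := by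
    rw [hh]; push_cast; field_simp
  have hhn : h / n ≤ 1 / 2 := by
    rw [div_le_iff₀ hn0]
    nlinarith
  have hhn0 : 0 ≤ h / n := by positivity
  have hmain := rstg_double_eq_top_ge (K := n ^ 2) hn (by positivity) (β n) (μ := μ) (Q := Q)
    (B := ((1 - n * (p / (2 * n ^ 2 : ℕ)))⁻¹) ^ (n ^ 2)) rfl rfl hμ8
    (by rw [hxeq]; linarith) rfl
  refine le_trans (ENNReal.ofReal_le_ofReal ?_) hmain
  rw [hxeq]
  have hB : ((1 - h / n)⁻¹) ^ (n ^ 2) ≤ n * E := by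
    calc ((1 - h / n)⁻¹) ^ (n ^ 2) ≤ Real.exp (h / n + 2 * (h / n) ^ 2) ^ (n ^ 2) := by
          refine pow_le_pow_left₀ (inv_nonneg.2 (by linarith)) (inv_one_sub_le_exp hhn0 hhn) _
      _ = Real.exp (n * h + 2 * h ^ 2) := by
          rw [← Real.exp_nat_mul]
          congr 1
          push_cast
          field_simp
      _ ≤ Real.exp (L + (2 + -(c / 2 * L))) := by
          refine Real.exp_le_exp.2 ?_
          nlinarith
      _ = n * E := by rw [hE, Real.exp_add, Real.exp_add, ← hexpL]
  have e1 : 4 * (1 / Q - 1) ≤ 8 * (L ^ 1 / n) := by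
    have : 1 / Q - 1 ≤ 2 * h := by
      rw [sub_le_iff_le_add, div_le_iff₀ hQ0, hQ, ← hh]
      nlinarith
    rw [pow_one]
    linarith
  have e2 : 4 / μ ≤ 4 * E := by
    rw [div_le_iff₀ (by linarith)]
    rw [div_le_iff₀ hE0] at hμE
    linarith
  have e3 : 16 * ((1 - h / n)⁻¹) ^ (n ^ 2) / (n * Q) ≤ 32 * E := by
    rw [div_le_iff₀ (by positivity)]
    have h1 : (1 / 2) * (n * E) ≤ Q * (n * E) := by gcongr
    calc 16 * ((1 - h / n)⁻¹) ^ (n ^ 2) ≤ 16 * (n * E) := by gcongr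
      _ ≤ 32 * (Q * (n * E)) := by linarith
      _ = _ := by ring
  linarith

end TemporalGraph

theorem mainTheorem6 (β : ℕ → unitInterval) :
    ((∃ c : ℝ, 0 < c ∧ ∀ᶠ n : ℕ in atTop, (2 + c) * (Real.log n / n) < (β n : ℝ)) →
      Tendsto (fun n : ℕ =>
          (TemporalGraph.rstg (Fin n) (β n)).toMeasure {H | H.double < ⊤})
        atTop (𝓝 1)) ∧
    ((∃ c : ℝ, 0 < c ∧ ∀ᶠ n : ℕ in atTop, (β n : ℝ) < (2 - c) * (Real.log n / n)) →
      Tendsto (fun n : ℕ =>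
          (TemporalGraph.rstg (Fin n) (β n)).toMeasure {H | H.double = ⊤})
        atTop (𝓝 1)) :=
  ⟨fun ⟨_, hc, h⟩ => TemporalGraph.tendsto_rstg_double_lt_top β hc h,
    fun ⟨_, hc, h⟩ => TemporalGraph.tendsto_rstg_double_eq_top β hc h⟩
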